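/- Let $P>0$, let $I\subset\mathbb R$ be a non-empty open interval (possibly unbounded), and let $\Omega=(\mathbb R/P\mathbb Z)\times I$ be the cylinder with coordinates $(x,\Phi)$ and area $dx\,d\Phi$. Let $T:\Omega\to\Omega$ be an area-preserving $C^1$ diffeomorphism with a lift $\tilde T(x,\Phi)=(y,\Psi)$ to $\mathbb R\times I$ that commutes with $(x,\Phi)\mapsto(x+P,\Phi)$ and satisfies the twist condition $\partial y/\partial\Phi\neq0$. Let $U=\{(x,y):\tilde T(x,\Phi)=(y,\Psi)\text{ for some }\Phi,\Psi\in I\}$, and let $L$ be a $C^2$ generating function of $T$ on $U$, that is, $\Phi=-L_1(x,y)$ and $\Psi=L_2(x,y)$ whenever $\tilde T(x,\Phi)=(y,\Psi)$ (subscripts denote partial derivatives). Assume $L_{12}>0$ on $U$ (negative twist). A configuration is a sequence $\{x_n\}_{n\in\mathbb Z}$ with $(x_n,x_{n+1})\in U$ that is an extremal of $\sum_n L(x_n,x_{n+1})$, i.e. $L_2(x_{n-1},x_n)+L_1(x_n,x_{n+1})=0$ for all $n$; configurations are exactly the sequences of $x$-coordinates of orbits of $\tilde T$. A Jacobi field along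 $\{x_n\}$ is a sequence $\{\xi_n\}_{n\in\mathbb Z}$ satisfying the discrete Jacobi equation $$L_{12}(x_{n-1},x_n)\xi_{n-1}+\bigl(L_{22}(x_{n-1},x_n)+L_{11}(x_n,x_{n+1})\bigr)\xi_n+L_{12}(x_n,x_{n+1})\xi_{n+1}=0\qquad(n\in\mathbb Z).$$ Points $x_M,x_N$, $M\ne N$, of the configuration are conjugate if some non-trivial Jacobi field along it vanishes at $M$ and at $N$. A configuration is locally maximizing if, for all $M<N$, the segment $x_M,\dots,x_N$ is a local maximum of $\sum_{n=M}^{N-1}L(x_n,x_{n+1})$ with $x_M$ and $x_N$ fixed. The following conditions are equivalent: (a) no configuration has conjugate points; (b) all configurations are locally maximizing; (c) there is a measurable function $\nu:\Omega\to(0,\infty)$ such that for every $z\in\Omega$ the cocycle $\nu_n(z)=\nu(z)\nu(Tz)\cdots\nu(T^{n-1}z)$ for $n\ge0$, $\nu_{-n}(z)=\bigl(\nu(T^{-1}z)\cdots\nu(T^{-n}z)\bigr)^{-1}$ for $n\ge1$, satisfies the discrete Jacobi equation along the configuration of the orbit of $z$; (d) there is a measurable, $T$-invariant field of tangent lines $l(z)\subset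 T_z\Omega$, defined for almost every $z\in\Omega$, which is non-vertical ($\partial/\partial\Phi\notin l(z)$) and monotone: when each line is oriented by $dx>0$, the maps $DT:l(z)\to l(Tz)$ preserve orientation. -/

import Mathlib

open MeasureTheory

noncomputable section

namespace TwistMaps

/-- The phase cylinder `(ℝ / Pℤ) × I`, with coordinates `(x, Φ)`; `I` is an interval.
Each tangent plane is identified with `ℝ × ℝ` by `(dx, dΦ)`. -/
abbrev Cyl (P : ℝ) (I : Set ℝ) : Type := AddCircle P × I

/-- The area `dx dΦ` on the cylinder. -/
def area (P : ℝ) [Fact (0 < P)] (I : Set ℝ) : Measure (Cyl P I) :=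
  (volume : Measure (AddCircle P)).prod (Measure.comap (Subtype.val : I → ℝ) volume)

/-- The universal cover `ℝ × I → (ℝ / Pℤ) × I`. -/
def proj (P : ℝ) (I : Set ℝ) (p : ℝ × I) : Cyl P I := ((p.1 : AddCircle P), p.2)

/-- The open strip `ℝ × I` as a subset of the plane. -/
def strip (I : Set ℝ) : Set (ℝ × ℝ) := {q | q.2 ∈ I}

open Classical in
/-- A self-map of `ℝ × I` read as a map of the plane; only its values on `strip I` matter
(the value outside is the dummy `0`). -/
def planar {I : Set ℝ} (F : ℝ × I → ℝ × I) (q : ℝ × ℝ) : ℝ × ℝ :=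
  if h : q.2 ∈ I then ((F (q.1, ⟨q.2, h⟩)).1, ((F (q.1, ⟨q.2, h⟩)).2 : ℝ)) else 0

/-- An area-preserving twist map of the cylinder: an area-preserving homeomorphism `map`, with a
lift `lift` to the universal cover that commutes with the deck translation, that is a
`C¹` diffeomorphism, and that satisfies the twist condition `∂y/∂Φ ≠ 0`, where
`lift (x, Φ) = (y, Ψ)`. -/
structure TwistMap (P : ℝ) [Fact (0 < P)] (I : Set ℝ) where
  map : Cyl P I ≃ₜ Cyl P I
  lift : (ℝ × I) ≃ₜ (ℝ × I)
  map_proj : ∀ p : ℝ × I, map (proj P I p) = proj P I (lift p)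
  lift_translate : ∀ (x : ℝ) (Φ : I), lift (x + P, Φ) = ((lift (x, Φ)).1 + P, (lift (x, Φ)).2)
  contDiffOn_lift : ContDiffOn ℝ 1 (planar lift) (strip I)
  contDiffOn_symm : ContDiffOn ℝ 1 (planar lift.symm) (strip I)
  measurePreserving : MeasurePreserving map (area P I) (area P I)
  twist : ∀ q ∈ strip I, (fderiv ℝ (planar lift) q (0, 1)).1 ≠ 0

/-- Partial derivative in the first variable. -/
def d1 (L : ℝ → ℝ → ℝ) (x y : ℝ) : ℝ := deriv (fun s => L s y) x

/-- Partial derivative in the second variable. -/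
def d2 (L : ℝ → ℝ → ℝ) (x y : ℝ) : ℝ := deriv (fun t => L x t) y

/-- `L₁₁`. -/
def L11 (L : ℝ → ℝ → ℝ) : ℝ → ℝ → ℝ := d1 (d1 L)

/-- `L₁₂`. -/
def L12 (L : ℝ → ℝ → ℝ) : ℝ → ℝ → ℝ := d2 (d1 L)

/-- `L₂₂`. -/
def L22 (L : ℝ → ℝ → ℝ) : ℝ → ℝ → ℝ := d2 (d2 L)

section Maps

variable {P : ℝ} [Fact (0 < P)] {I : Set ℝ}

/-- The pairs `(x, y)` such that the lift sends some `(x, Φ)` to some `(y, Ψ)`; the generating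
function lives on this set. -/
def TwistMap.pairs (T : TwistMap P I) : Set (ℝ × ℝ) :=
  Set.range fun p : ℝ × I => (p.1, (T.lift p).1)

/-- `L` is a (`C²`) generating function of `T`: `T (x, Φ) = (y, Ψ)` with `Φ = -L₁(x, y)` and
`Ψ = L₂(x, y)`. -/
structure IsGeneratingFunction (T : TwistMap P I) (L : ℝ → ℝ → ℝ) : Prop where
  contDiffOn : ContDiffOn ℝ 2 (fun q : ℝ × ℝ => L q.1 q.2) T.pairs
  fst_eq : ∀ p : ℝ × I, (p.2 : ℝ) = -d1 L p.1 (T.lift p).1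
  snd_eq : ∀ p : ℝ × I, ((T.lift p).2 : ℝ) = d2 L p.1 (T.lift p).1

/-- Configurations: the bi-infinite extremals of the formal action `∑ L (x n) (x (n + 1))`. -/
def IsConfiguration (T : TwistMap P I) (L : ℝ → ℝ → ℝ) (x : ℤ → ℝ) : Prop :=
  (∀ n, (x n, x (n + 1)) ∈ T.pairs) ∧
    ∀ n, d2 L (x (n - 1)) (x n) + d1 L (x n) (x (n + 1)) = 0

/-- The sequence `ξ` satisfies the discrete Jacobi equation along `x`. -/
def IsJacobiField (L : ℝ → ℝ → ℝ) (x ξ : ℤ → ℝ) : Prop :=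
  ∀ n, L12 L (x (n - 1)) (x n) * ξ (n - 1)
      + (L22 L (x (n - 1)) (x n) + L11 L (x n) (x (n + 1))) * ξ n
      + L12 L (x n) (x (n + 1)) * ξ (n + 1) = 0

/-- The points `x M` and `x N` of `x` are conjugate. -/
def Conjugate (L : ℝ → ℝ → ℝ) (x : ℤ → ℝ) (M N : ℤ) : Prop :=
  ∃ ξ : ℤ → ℝ, IsJacobiField L x ξ ∧ ξ ≠ 0 ∧ ξ M = 0 ∧ ξ N = 0

/-- No two (distinct) points of `x` are conjugate. -/
def NoConjugatePoints (L : ℝ → ℝ → ℝ) (x : ℤ → ℝ) : Prop :=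
  ∀ M N : ℤ, M ≠ N → ¬ Conjugate L x M N

/-- The action of the segment `x M, …, x N`. -/
def action (L : ℝ → ℝ → ℝ) (M N : ℤ) (x : ℤ → ℝ) : ℝ :=
  ∑ k ∈ Finset.Ico M N, L (x k) (x (k + 1))

/-- Every finite segment of `x` is a local maximum of the action with fixed end points. -/
def LocallyMaximizing (L : ℝ → ℝ → ℝ) (x : ℤ → ℝ) : Prop :=
  ∀ M N : ℤ, M < N → ∃ ε > 0, ∀ y : ℤ → ℝ, y M = x M → y N = x N →
    (∀ k ∈ Finset.Icc M N, |y k - x k| < ε) → action L M N y ≤ action L M N x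

/-- The cocycle over `T` generated by `ν`: `ν z * ν (T z) * ⋯ * ν (T ^ (n - 1) z)` for `n ≥ 0`, and
`(ν (T⁻¹ z) * ⋯ * ν (T ^ (-n) z))⁻¹` at `-n`. -/
def cocycle {Ω : Type*} (T : Equiv.Perm Ω) (ν : Ω → ℝ) (z : Ω) : ℤ → ℝ
  | Int.ofNat n => ∏ k ∈ Finset.range n, ν ((T ^ k) z)
  | Int.negSucc n => (∏ k ∈ Finset.range (n + 1), ν ((T.symm ^ (k + 1)) z))⁻¹

/-- The configuration of the orbit of `p`: the `x`-coordinates of its (lifted) orbit. -/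
def TwistMap.config (T : TwistMap P I) (p : ℝ × I) (n : ℤ) : ℝ :=
  (((T.lift.toEquiv : Equiv.Perm (ℝ × I)) ^ n) p).1

/-- The differential of `T` at `proj P I p`, in the coordinates `(dx, dΦ)`. -/
def TwistMap.differential (T : TwistMap P I) (p : ℝ × I) : ℝ × ℝ →L[ℝ] ℝ × ℝ :=
  fderiv ℝ (planar T.lift) (p.1, (p.2 : ℝ))

/-- `l` is a measurable, non-vertical, monotone sub-bundle of tangent lines, defined almost
everywhere and invariant under `T`. The values of `l` on a null set are irrelevant.
Monotone: the lines are oriented by `dx > 0`, and the differential of `T` respects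
these orientations. -/
structure IsMonotoneInvariantSubbundle (T : TwistMap P I)
    (l : Cyl P I → Submodule ℝ (ℝ × ℝ)) : Prop where
  measurable_line : ∃ w : Cyl P I → ℝ × ℝ, Measurable w ∧
    ∀ᵐ z ∂(area P I), w z ≠ 0 ∧ l z = Submodule.span ℝ {w z}
  nonvertical : ∀ᵐ z ∂(area P I), ((0, 1) : ℝ × ℝ) ∉ l z
  invariant : ∀ᵐ z ∂(area P I), ∀ p : ℝ × I, proj P I p = z →
    (l z).map (T.differential p : ℝ × ℝ →ₗ[ℝ] ℝ × ℝ) = l (T.map z)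
  monotone : ∀ᵐ z ∂(area P I), ∀ p : ℝ × I, proj P I p = z →
    ∀ v ∈ l z, 0 < v.1 → 0 < (T.differential p v).1

end Maps

end TwistMaps

end

namespace TwistMaps

open Set Filter Topology

/-! Everything passes through one condition: `0 < T.vertField p (n + 1)` for all `n` and `p`, that
is, the downward vertical vector, pushed forward by any positive number of steps, always points to
the right. Its `x`-components form the Jacobi field that vanishes at time `0`, and negative twist
gives positivity at time `1`.

Without conjugate points these fields never vanish again, but this leaves open that they change sign
between two consecutive times. By connectedness such a change would occur at all points
simultaneously, so two negative twists would compose to a positive twist.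
`IsNegTwist.not_strictMono_comp` excludes this topologically; `vertField_succ_pos` turns it into an
induction step.

Given the condition, a vertical vector started one step before a segment yields a Jacobi field
positive on the whole segment. A strict supersolution near it makes the second variation nonpositive
at all nearby sequences, so the segment is a local maximum (`exists_segAction_le`). Conversely, a
Jacobi field with two zeros, cut off at the second one and perturbed there, gives a positive second
variation on a segment longer by one step (`noConjugatePoints_of_locallyMaximizing`).

For the cocycle, take the growth ratios of the fields vanishing ever further in the past. They
decrease, by monotonicity of the Riccati recursion, and their limit is a positive measurable
solution (`exists_riccati_solution`). That solution is the slope of an invariant line field in the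
coordinates `(x, y)`, which gives the subbundle. Finally, a monotone invariant line field carries a
vector with positive `x`-component along almost every orbit; the constant Wronskian then forces the
vertical fields to be positive there, and continuity with the Jacobi equation extends this to every
orbit (`vertField_pos_of_subbundle`). -/

theorem tendsto_atTop_of_add_period {P : ℝ} (hP : 0 < P) {f : ℝ → ℝ} (hf : Continuous f)
    (hper : ∀ x, f (x + P) = f x + P) : Tendsto f atTop atTop := by
  have hp : Function.Periodic (fun x => f x - x) P := fun x => by
    simp only [hper]; ring
  obtain ⟨C, hC⟩ := (hp.isBounded_of_continuous hP.ne' (by fun_prop)).bddBelow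
  refine tendsto_atTop_mono (fun x => ?_) (tendsto_atTop_add_const_right atTop C tendsto_id)
  have := hC (mem_range_self x)
  simp only [id_eq] at *
  linarith

/-! ### Topology of negative twists: behaviour at the ends of the strip, and composition. -/

section Ends

variable {J : Type*}

/-- A homeomorphism of the strip `ℝ × J` that commutes with the translation by `P`, moves each
fibre monotonically to the left, and whose inverse moves each fibre monotonically to the right. -/
structure IsNegTwist [Preorder J] [TopologicalSpace J] (P : ℝ) (A : ℝ × J ≃ₜ ℝ × J) : Prop where
  translate : ∀ x Φ, A (x + P, Φ) = ((A (x, Φ)).1 + P, (A (x, Φ)).2)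
  anti : ∀ x, StrictAnti fun Φ => (A (x, Φ)).1
  mono_symm : ∀ y, StrictMono fun Ψ => (A.symm (y, Ψ)).1

namespace IsNegTwist

variable [ConditionallyCompleteLinearOrder J] [TopologicalSpace J] {P : ℝ} {A B : ℝ × J ≃ₜ ℝ × J}

theorem translate_symm (hA : IsNegTwist P A) (y : ℝ) (Ψ : J) :
    A.symm (y + P, Ψ) = ((A.symm (y, Ψ)).1 + P, (A.symm (y, Ψ)).2) := by
  rw [Homeomorph.symm_apply_eq, hA.translate]
  simp

theorem translate_symm_int (hA : IsNegTwist P A) (y : ℝ) (Ψ : J) (k : ℤ) :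
    A.symm (y + k * P, Ψ) = ((A.symm (y, Ψ)).1 + k * P, (A.symm (y, Ψ)).2) := by
  have step : ∀ j : ℤ, A.symm (y + (j + 1 : ℤ) * P, Ψ)
      = ((A.symm (y + j * P, Ψ)).1 + P, (A.symm (y + j * P, Ψ)).2) := fun j => by
    rw [← hA.translate_symm, show y + ((j + 1 : ℤ) : ℝ) * P = y + j * P + P by push_cast; ring]
  induction k using Int.induction_on with
  | zero => simp
  | succ n ih =>
    rw [step, ih]
    refine Prod.ext ?_ rfl
    push_cast
    ring
  | pred n ih =>
    have := step (-n - 1)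
    rw [sub_add_cancel, ih, Prod.ext_iff] at this
    refine Prod.ext ?_ this.2.symm
    have h1 := this.1
    push_cast at h1 ⊢
    linarith

/-- Time reversal combined with reversal of the fibre order is a symmetry of the notion, so each
result about the lower end of `A` gives one about the upper end of `A.symm`. -/
theorem dual_symm (hA : IsNegTwist P A) :
    IsNegTwist (J := Jᵒᵈ) P (show ℝ × Jᵒᵈ ≃ₜ ℝ × Jᵒᵈ from A.symm) where
  translate := hA.translate_symm
  anti y := (hA.mono_symm y).dual_left
  mono_symm x := (hA.anti x).dual_left

theorem tendsto_fst (hP : 0 < P) (hA : IsNegTwist P A) (Φ : J) :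
    Tendsto (fun x => (A (x, Φ)).1) atTop atTop :=
  tendsto_atTop_of_add_period hP (by fun_prop) fun x => by rw [hA.translate]

theorem tendsto_symm_fst (hP : 0 < P) (hA : IsNegTwist P A) (Ψ : J) :
    Tendsto (fun y => (A.symm (y, Ψ)).1) atTop atTop :=
  tendsto_atTop_of_add_period hP (by fun_prop) fun x => by rw [hA.translate_symm]

variable [OrderTopology J]

/-- Properness of `A` on the quotient cylinder: modulo translation the band `Icc d d'` is compact,
so its preimage is bounded below in the fibre direction. -/
theorem exists_forall_le_notMem_Icc [NoMinOrder J] (hP : 0 < P) (hA : IsNegTwist P A) (x : ℝ)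
    (d d' : J) : ∃ c, ∀ Φ ≤ c, (A (x, Φ)).2 ∉ Icc d d' := by
  have hK : IsCompact ((fun q => (A.symm q).2) '' (Icc 0 P ×ˢ Icc d d')) :=
    (isCompact_Icc.prod isCompact_Icc).image (by fun_prop)
  have : Nonempty J := ⟨d⟩
  obtain ⟨c, hc⟩ := hK.bddBelow
  obtain ⟨c', hc'⟩ := exists_lt c
  refine ⟨c', fun Φ hΦ hmem => ?_⟩
  refine (hΦ.trans_lt hc').not_ge (hc ?_)
  set y := (A (x, Φ)).1 with hy
  refine ⟨(y + ((-⌊y / P⌋ : ℤ) : ℝ) * P, (A (x, Φ)).2), ⟨?_, hmem⟩, ?_⟩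
  · have h1 := Int.floor_le (y / P)
    have h2 := (Int.lt_floor_add_one (y / P)).le
    rw [le_div_iff₀ hP] at h1
    rw [div_le_iff₀ hP] at h2
    constructor <;> push_cast <;> nlinarith
  · simp only [hA.translate_symm_int, hy, Prod.mk.eta, Homeomorph.symm_apply_apply]

/-- A negative twist cannot interchange the ends of the strip. -/
theorem exists_forall_le_snd_lt [DenselyOrdered J] [NoMinOrder J] (hP : 0 < P)
    (hA : IsNegTwist P A) (x : ℝ) (d : J) : ∃ c, ∀ Φ ≤ c, (A (x, Φ)).2 < d := by
  by_contra! hcon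
  have : Nonempty J := ⟨d⟩
  have hcont : Continuous fun Φ => (A (x, Φ)).2 := by fun_prop
  -- Near the lower end the image avoids every compact band, so by connectedness it stays on one
  -- side of it; by `hcon` this must be the upper side.
  have hflip : ∀ d', ∃ c, ∀ Φ ≤ c, d' < (A (x, Φ)).2 := by
    intro d'
    obtain ⟨c, hc⟩ := hA.exists_forall_le_notMem_Icc hP x d (max d d')
    refine ⟨c, fun Φ hΦ => ?_⟩
    suffices h : d ≤ (A (x, Φ)).2 by
      have := hc Φ hΦ
      rw [mem_Icc, not_and, not_le] at this
      exact (le_max_right _ _).trans_lt (this h)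
    by_contra! hlt
    obtain ⟨Φ', hΦ', hd⟩ := hcon c
    obtain ⟨Φ'', h1, h2⟩ := (isPreconnected_Iic (a := c)).intermediate_value
      (mem_Iic.2 hΦ) (mem_Iic.2 hΦ') hcont.continuousOn ⟨hlt.le, hd⟩
    exact hc Φ'' h1 ⟨h2.ge, h2.le.trans (le_max_left _ _)⟩
  have hlt : ∀ d', ∃ c, ∀ Φ ≤ c, (A.symm ((A (x, Φ)).1, d')).1 < x := by
    intro d'
    obtain ⟨c, hc⟩ := hflip d'
    refine ⟨c, fun Φ hΦ => ?_⟩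
    have := hA.mono_symm (A (x, Φ)).1 (hc Φ hΦ)
    simpa using this
  have hbdd : BddAbove (range fun Φ => (A (x, Φ)).1) := by
    obtain ⟨C, hC⟩ := eventually_atTop.1
      ((hA.tendsto_symm_fst hP d).eventually (eventually_ge_atTop x))
    obtain ⟨c, hc⟩ := hlt d
    refine ⟨C, ?_⟩
    rintro _ ⟨Φ, rfl⟩
    have h1 : (A (x, min Φ c)).1 < C := by
      by_contra! h
      exact (hc _ (min_le_right _ _)).not_ge (hC _ h)
    exact ((hA.anti x).antitone (min_le_left Φ c)).trans h1.le
  set Y := ⨆ Φ, (A (x, Φ)).1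
  have hlim : Tendsto (fun Φ => (A (x, Φ)).1) atBot (𝓝 Y) :=
    tendsto_atBot_ciSup (hA.anti x).antitone hbdd
  -- In the limit `Φ → -∞` the whole fibre over `Y` pulls back to the left of `x`. The horizontal
  -- curve `x' ↦ A (x', d)` with `x' ≥ x` contradicts this, since it starts strictly left of that
  -- fibre and must cross it.
  have hle : ∀ Ψ, (A.symm (Y, Ψ)).1 ≤ x := by
    intro Ψ
    have hc : Continuous fun y => (A.symm (y, Ψ)).1 := by fun_prop
    obtain ⟨c, h⟩ := hlt Ψ
    exact le_of_tendsto ((hc.tendsto Y).comp hlim)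
      (eventually_atBot.2 ⟨c, fun Φ hΦ => (h Φ hΦ).le⟩)
  obtain ⟨d₁, hd₁⟩ := exists_lt d
  have hdY : (A (x, d)).1 < Y := (hA.anti x hd₁).trans_le (le_ciSup hbdd d₁)
  obtain ⟨X, hX1, hX2⟩ := (((hA.tendsto_fst hP d).eventually (eventually_ge_atTop Y)).and
    (eventually_ge_atTop x)).exists
  have hc : Continuous fun x => (A (x, d)).1 := by fun_prop
  obtain ⟨x', hx', hx'Y⟩ := intermediate_value_Icc hX2 hc.continuousOn ⟨hdY.le, hX1⟩
  have := hle (A (x', d)).2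
  have h2 : (A.symm (Y, (A (x', d)).2)).1 = x' := by
    simp only at hx'Y
    rw [← hx'Y, Prod.mk.eta, Homeomorph.symm_apply_apply]
  have h3 : x' = x := le_antisymm (h2 ▸ this) hx'.1
  subst h3
  exact hdY.ne hx'Y

theorem exists_forall_ge_lt_symm_snd [DenselyOrdered J] [NoMaxOrder J] (hP : 0 < P)
    (hA : IsNegTwist P A) (y : ℝ) (d : J) : ∃ c, ∀ Ψ ≥ c, d < (A.symm (y, Ψ)).2 :=
  hA.dual_symm.exists_forall_le_snd_lt hP y d

/-- The composition of two negative twists is not a positive twist on any fibre. -/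
theorem not_strictMono_comp [DenselyOrdered J] [NoMinOrder J] [NoMaxOrder J] [Nonempty J]
    (hP : 0 < P) (hA : IsNegTwist P A) (hB : IsNegTwist P B) (x : ℝ) :
    ¬ StrictMono fun Φ => (B (A (x, Φ))).1 := by
  intro hc
  obtain ⟨Φ₀⟩ := ‹Nonempty J›
  set a : J → ℝ := fun Φ => (A (x, Φ)).1 with ha
  set c : J → ℝ := fun Φ => (B (A (x, Φ))).1 with hcdef
  have ha_anti : StrictAnti a := hA.anti x
  have hca : ∀ Φ, (B (a Φ, (A (x, Φ)).2)).1 = c Φ := fun Φ => rfl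
  have hfst : ∀ Φ', Continuous fun x => (B (x, Φ')).1 := fun Φ' => by fun_prop
  have hlow : ∀ Φ', ∃ e, ∀ Φ ≤ e, (B (a Φ, Φ')).1 < c Φ := by
    intro Φ'
    obtain ⟨e, he⟩ := hA.exists_forall_le_snd_lt hP x Φ'
    exact ⟨e, fun Φ hΦ => hB.anti (a Φ) (he Φ hΦ)⟩
  -- If `a` were unbounded, `B (a Φ, Φ₀)` would run off to the right, whereas `hlow` and the assumed
  -- monotonicity of `c` keep it left of `c Φ₀`.
  have hbdd : BddAbove (range a) := by
    obtain ⟨C, hC⟩ := eventually_atTop.1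
      ((hB.tendsto_fst hP Φ₀).eventually (eventually_ge_atTop (c Φ₀)))
    obtain ⟨e, he⟩ := hlow Φ₀
    refine ⟨C, ?_⟩
    rintro _ ⟨Φ, rfl⟩
    have h1 : a (min Φ (min e Φ₀)) < C := by
      by_contra! h
      have h1 := hC _ h
      have h2 := he (min Φ (min e Φ₀)) ((min_le_right _ _).trans (min_le_left _ _))
      have h3 := hc.monotone ((min_le_right Φ (min e Φ₀)).trans (min_le_right _ _))
      exact (h1.trans_lt h2).not_ge h3
    exact (ha_anti.antitone (min_le_left Φ _)).trans h1.le
  set aSup := ⨆ Φ, a Φ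
  have ha_lim : Tendsto a atBot (𝓝 aSup) := tendsto_atBot_ciSup ha_anti.antitone hbdd
  have ha_lt : ∀ Φ, a Φ < aSup := fun Φ => by
    obtain ⟨Φ', h⟩ := exists_lt Φ
    exact (ha_anti h).trans_le (le_ciSup hbdd Φ')
  have hB_le : ∀ Φ Φ', (B (aSup, Φ')).1 ≤ c Φ := by
    intro Φ Φ'
    obtain ⟨e, he⟩ := hlow Φ'
    refine le_of_tendsto (((hfst Φ').tendsto aSup).comp ha_lim)
      (eventually_atBot.2 ⟨min e Φ, fun Φ'' h => ?_⟩)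
    exact (he Φ'' (h.trans (min_le_left _ _))).le.trans
      (hc.monotone (h.trans (min_le_right _ _)))
  have hB_lt : ∀ Φ', (B (aSup, Φ')).1 < c Φ₀ := fun Φ' => by
    obtain ⟨Φ, h⟩ := exists_lt Φ₀
    exact (hB_le Φ Φ').trans_lt (hc h)
  -- The `B`-preimage of the fibre over `c Φ₀`. It starts moving right from `a Φ₀` but cannot reach
  -- `aSup`, whose fibre `B` maps strictly left of `c Φ₀`; its supremum is therefore some `a Φ₁`
  -- with `Φ₁ < Φ₀`, and `hB_ge` there yields `c Φ₁ ≥ c Φ₀`.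
  set u : J → ℝ := fun Ψ => (B.symm (c Φ₀, Ψ)).1 with hu
  have hu_mono : StrictMono u := hB.mono_symm _
  have hBu : ∀ Ψ, (B (u Ψ, (B.symm (c Φ₀, Ψ)).2)).1 = c Φ₀ := fun Ψ => by
    simp only [hu, Prod.mk.eta, Homeomorph.apply_symm_apply]
  have hu₀ : u (B (A (x, Φ₀))).2 = a Φ₀ := by
    simp only [hu, hcdef, Prod.mk.eta, Homeomorph.symm_apply_apply, ha]
  have hu_cont : Continuous u := by simp only [hu]; fun_prop
  have hu_lt : ∀ Ψ, u Ψ < aSup := by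
    intro Ψ
    by_contra! h
    obtain ⟨Ψ', -, h'⟩ := (isPreconnected_univ (α := J)).intermediate_value
      (mem_univ _) (mem_univ _) hu_cont.continuousOn ⟨(hu₀.trans_lt (ha_lt Φ₀)).le, h⟩
    have := hBu Ψ'
    rw [h'] at this
    exact (hB_lt _).ne this
  have hu_bdd : BddAbove (range u) := ⟨aSup, by rintro _ ⟨Ψ, rfl⟩; exact (hu_lt Ψ).le⟩
  set uSup := ⨆ Ψ, u Ψ
  have hu_lim : Tendsto u atTop (𝓝 uSup) := tendsto_atTop_ciSup hu_mono.monotone hu_bdd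
  have hB_ge : ∀ Φ', c Φ₀ ≤ (B (uSup, Φ')).1 := by
    intro Φ'
    obtain ⟨e, he⟩ := hB.exists_forall_ge_lt_symm_snd hP (c Φ₀) Φ'
    refine ge_of_tendsto (((hfst Φ').tendsto uSup).comp hu_lim)
      (eventually_atTop.2 ⟨e, fun Ψ h => ?_⟩)
    have := hB.anti (u Ψ) (he Ψ h)
    simp only [hBu] at this
    exact this.le
  have huSup_le : uSup ≤ aSup := ciSup_le fun Ψ => (hu_lt Ψ).le
  have huSup_lt : uSup < aSup := lt_of_le_of_ne huSup_le fun h => by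
    have h1 := hB_ge Φ₀
    rw [h] at h1
    exact h1.not_gt (hB_lt Φ₀)
  have huSup_gt : a Φ₀ < uSup := by
    obtain ⟨Ψ, h⟩ := exists_gt (B (A (x, Φ₀))).2
    exact hu₀ ▸ (hu_mono h).trans_le (le_ciSup hu_bdd Ψ)
  obtain ⟨Φ₂, hΦ₂⟩ := ((ha_lim.eventually (eventually_gt_nhds huSup_lt))).exists
  have ha_cont : Continuous a := by simp only [ha]; fun_prop
  obtain ⟨Φ₁, -, hΦ₁⟩ := (isPreconnected_univ (α := J)).intermediate_value
      (mem_univ _) (mem_univ _) ha_cont.continuousOn ⟨huSup_gt.le, hΦ₂.le⟩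
  have h1 : Φ₁ < Φ₀ := ha_anti.lt_iff_gt.1 (hΦ₁ ▸ huSup_gt)
  have h2 := hB_ge (A (x, Φ₁)).2
  rw [← hΦ₁, hca] at h2
  exact (hc h1).not_ge h2

end IsNegTwist

end Ends

/-! ### First and second partial derivatives of a `C²` function. -/

section PartialDerivatives

theorem d1_eq_of_hasFDerivAt {f : ℝ → ℝ → ℝ} {f' : ℝ × ℝ →L[ℝ] ℝ} {q : ℝ × ℝ}
    (h : HasFDerivAt (fun q : ℝ × ℝ => f q.1 q.2) f' q) : d1 f q.1 q.2 = f' (1, 0) := by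
  have h1 : HasDerivAt (fun s : ℝ => (s, q.2)) ((1 : ℝ), (0 : ℝ)) q.1 :=
    (hasDerivAt_id _).prodMk (hasDerivAt_const _ _)
  exact (HasFDerivAt.comp_hasDerivAt (f := fun s : ℝ => (s, q.2)) q.1 h h1).deriv

theorem d2_eq_of_hasFDerivAt {f : ℝ → ℝ → ℝ} {f' : ℝ × ℝ →L[ℝ] ℝ} {q : ℝ × ℝ}
    (h : HasFDerivAt (fun q : ℝ × ℝ => f q.1 q.2) f' q) : d2 f q.1 q.2 = f' (0, 1) := by
  have h1 : HasDerivAt (fun t : ℝ => (q.1, t)) ((0 : ℝ), (1 : ℝ)) q.2 :=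
    (hasDerivAt_const _ _).prodMk (hasDerivAt_id _)
  exact (HasFDerivAt.comp_hasDerivAt (f := fun t : ℝ => (q.1, t)) q.2 h h1).deriv

/-- The linear form `(v₁, v₂) ↦ a v₁ + b v₂`. -/
def linForm (a b : ℝ) : ℝ × ℝ →L[ℝ] ℝ :=
  a • ContinuousLinearMap.fst ℝ ℝ ℝ + b • ContinuousLinearMap.snd ℝ ℝ ℝ

@[simp] theorem linForm_apply (a b : ℝ) (v : ℝ × ℝ) : linForm a b v = a * v.1 + b * v.2 := by
  simp [linForm]

theorem eq_linForm (f : ℝ × ℝ →L[ℝ] ℝ) : f = linForm (f (1, 0)) (f (0, 1)) := by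
  ext <;> simp

theorem hasFDerivAt_linForm {f : ℝ → ℝ → ℝ} {f' : ℝ × ℝ →L[ℝ] ℝ} {q : ℝ × ℝ}
    (h : HasFDerivAt (fun q : ℝ × ℝ => f q.1 q.2) f' q) :
    HasFDerivAt (fun q : ℝ × ℝ => f q.1 q.2) (linForm (d1 f q.1 q.2) (d2 f q.1 q.2)) q := by
  rw [d1_eq_of_hasFDerivAt h, d2_eq_of_hasFDerivAt h, ← eq_linForm]
  exact h

variable {L : ℝ → ℝ → ℝ} {U : Set (ℝ × ℝ)}

theorem hasFDerivAt_of_contDiffOn (hU : IsOpen U)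
    (hL : ContDiffOn ℝ 2 (fun q : ℝ × ℝ => L q.1 q.2) U) {q : ℝ × ℝ} (hq : q ∈ U) :
    HasFDerivAt (fun q : ℝ × ℝ => L q.1 q.2) (linForm (d1 L q.1 q.2) (d2 L q.1 q.2)) q :=
  hasFDerivAt_linForm
    ((hL.differentiableOn (by norm_num)).differentiableAt (hU.mem_nhds hq)).hasFDerivAt

theorem hasFDerivAt_fderiv_of_contDiffOn (hU : IsOpen U)
    (hL : ContDiffOn ℝ 2 (fun q : ℝ × ℝ => L q.1 q.2) U) {q : ℝ × ℝ} (hq : q ∈ U) :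
    HasFDerivAt (fderiv ℝ (fun q : ℝ × ℝ => L q.1 q.2))
      (fderiv ℝ (fderiv ℝ (fun q : ℝ × ℝ => L q.1 q.2)) q) q :=
  (((hL.fderiv_of_isOpen hU (m := 1) (by norm_num)).differentiableOn
    (by norm_num)).differentiableAt (hU.mem_nhds hq)).hasFDerivAt

theorem hasFDerivAt_d1_aux (hU : IsOpen U)
    (hL : ContDiffOn ℝ 2 (fun q : ℝ × ℝ => L q.1 q.2) U) {q : ℝ × ℝ} (hq : q ∈ U) :
    HasFDerivAt (fun q : ℝ × ℝ => d1 L q.1 q.2)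
      ((fderiv ℝ (fderiv ℝ (fun q : ℝ × ℝ => L q.1 q.2)) q).flip (1, 0)) q := by
  refine ((hasFDerivAt_fderiv_of_contDiffOn hU hL hq).clm_apply
    (hasFDerivAt_const ((1 : ℝ), (0 : ℝ)) q)).congr_of_eventuallyEq ?_ |>.congr_fderiv ?_
  · filter_upwards [hU.mem_nhds hq] with q' hq'
    exact d1_eq_of_hasFDerivAt
      ((hL.differentiableOn (by norm_num)).differentiableAt (hU.mem_nhds hq')).hasFDerivAt
  · simp

theorem hasFDerivAt_d2_aux (hU : IsOpen U)
    (hL : ContDiffOn ℝ 2 (fun q : ℝ × ℝ => L q.1 q.2) U) {q : ℝ × ℝ} (hq : q ∈ U) :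
    HasFDerivAt (fun q : ℝ × ℝ => d2 L q.1 q.2)
      ((fderiv ℝ (fderiv ℝ (fun q : ℝ × ℝ => L q.1 q.2)) q).flip (0, 1)) q := by
  refine ((hasFDerivAt_fderiv_of_contDiffOn hU hL hq).clm_apply
    (hasFDerivAt_const ((0 : ℝ), (1 : ℝ)) q)).congr_of_eventuallyEq ?_ |>.congr_fderiv ?_
  · filter_upwards [hU.mem_nhds hq] with q' hq'
    exact d2_eq_of_hasFDerivAt
      ((hL.differentiableOn (by norm_num)).differentiableAt (hU.mem_nhds hq')).hasFDerivAt
  · simp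

theorem hasFDerivAt_d1 (hU : IsOpen U)
    (hL : ContDiffOn ℝ 2 (fun q : ℝ × ℝ => L q.1 q.2) U) {q : ℝ × ℝ} (hq : q ∈ U) :
    HasFDerivAt (fun q : ℝ × ℝ => d1 L q.1 q.2) (linForm (L11 L q.1 q.2) (L12 L q.1 q.2)) q :=
  hasFDerivAt_linForm (hasFDerivAt_d1_aux hU hL hq)

/-- Symmetry of the second derivative lets `L12` serve as the mixed partial here too. -/
theorem hasFDerivAt_d2 (hU : IsOpen U)
    (hL : ContDiffOn ℝ 2 (fun q : ℝ × ℝ => L q.1 q.2) U) {q : ℝ × ℝ} (hq : q ∈ U) :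
    HasFDerivAt (fun q : ℝ × ℝ => d2 L q.1 q.2) (linForm (L12 L q.1 q.2) (L22 L q.1 q.2)) q := by
  have h := hasFDerivAt_linForm (hasFDerivAt_d2_aux hU hL hq)
  have h12 : L12 L q.1 q.2 = d1 (d2 L) q.1 q.2 := by
    rw [L12, d2_eq_of_hasFDerivAt (hasFDerivAt_d1_aux hU hL hq),
      d1_eq_of_hasFDerivAt (hasFDerivAt_d2_aux hU hL hq)]
    exact ((hL.contDiffAt (hU.mem_nhds hq)).isSymmSndFDerivAt (by simp)) _ _
  rw [h12]
  exact h

theorem continuousOn_second_fderiv (hU : IsOpen U)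
    (hL : ContDiffOn ℝ 2 (fun q : ℝ × ℝ => L q.1 q.2) U) :
    ContinuousOn (fderiv ℝ (fderiv ℝ (fun q : ℝ × ℝ => L q.1 q.2))) U :=
  (hL.fderiv_of_isOpen hU (m := 1) (by norm_num)).continuousOn_fderiv_of_isOpen hU (by norm_num)

theorem continuousOn_L11 (hU : IsOpen U)
    (hL : ContDiffOn ℝ 2 (fun q : ℝ × ℝ => L q.1 q.2) U) :
    ContinuousOn (fun q : ℝ × ℝ => L11 L q.1 q.2) U :=
  (((continuousOn_second_fderiv hU hL).clm_apply
    (continuousOn_const (c := ((1, 0) : ℝ × ℝ)))).clm_apply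
    (continuousOn_const (c := ((1, 0) : ℝ × ℝ)))).congr
    fun _ hq => by exact (d1_eq_of_hasFDerivAt (hasFDerivAt_d1_aux hU hL hq) :)

theorem continuousOn_L12 (hU : IsOpen U)
    (hL : ContDiffOn ℝ 2 (fun q : ℝ × ℝ => L q.1 q.2) U) :
    ContinuousOn (fun q : ℝ × ℝ => L12 L q.1 q.2) U :=
  (((continuousOn_second_fderiv hU hL).clm_apply
    (continuousOn_const (c := ((0, 1) : ℝ × ℝ)))).clm_apply
    (continuousOn_const (c := ((1, 0) : ℝ × ℝ)))).congr
    fun _ hq => by exact (d2_eq_of_hasFDerivAt (hasFDerivAt_d1_aux hU hL hq) :)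

theorem continuousOn_L22 (hU : IsOpen U)
    (hL : ContDiffOn ℝ 2 (fun q : ℝ × ℝ => L q.1 q.2) U) :
    ContinuousOn (fun q : ℝ × ℝ => L22 L q.1 q.2) U :=
  (((continuousOn_second_fderiv hU hL).clm_apply
    (continuousOn_const (c := ((0, 1) : ℝ × ℝ)))).clm_apply
    (continuousOn_const (c := ((0, 1) : ℝ × ℝ)))).congr
    fun _ hq => by exact (d2_eq_of_hasFDerivAt (hasFDerivAt_d2_aux hU hL hq) :)

end PartialDerivatives

/-! ### Transfer between the strip and the plane. -/

section Planar

variable {I : Set ℝ}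

theorem isOpen_strip (hI : IsOpen I) : IsOpen (strip I) := hI.preimage continuous_snd

theorem coe_mem_strip (p : ℝ × I) : (p.1, (p.2 : ℝ)) ∈ strip I := p.2.2

@[simp] theorem planar_coe (F : ℝ × I → ℝ × I) (p : ℝ × I) :
    planar F (p.1, (p.2 : ℝ)) = ((F p).1, ((F p).2 : ℝ)) := by
  simp [planar]

theorem exists_coe_eq {q : ℝ × ℝ} (hq : q ∈ strip I) : ∃ p : ℝ × I, (p.1, (p.2 : ℝ)) = q :=
  ⟨(q.1, ⟨q.2, hq⟩), rfl⟩

theorem planar_comp (F G : ℝ × I → ℝ × I) {q : ℝ × ℝ} (hq : q ∈ strip I) :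
    planar (F ∘ G) q = planar F (planar G q) := by
  obtain ⟨p, rfl⟩ := exists_coe_eq hq
  simp

theorem planar_mem_strip (F : ℝ × I → ℝ × I) {q : ℝ × ℝ} (hq : q ∈ strip I) :
    planar F q ∈ strip I := by
  obtain ⟨p, rfl⟩ := exists_coe_eq hq
  simpa using coe_mem_strip (F p)

theorem planar_eq_self {F : ℝ × I → ℝ × I} (hF : ∀ p, F p = p) {q : ℝ × ℝ} (hq : q ∈ strip I) :
    planar F q = q := by
  obtain ⟨p, rfl⟩ := exists_coe_eq hq
  simp [hF]

theorem hasDerivAt_fst_fibre {F : ℝ × I → ℝ × I} {F' : ℝ × ℝ →L[ℝ] ℝ × ℝ} {p : ℝ × I}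
    (h : HasFDerivAt (planar F) F' (p.1, (p.2 : ℝ))) :
    HasDerivAt (fun Φ : ℝ => (planar F (p.1, Φ)).1) (F' (0, 1)).1 p.2 := by
  have h1 : HasDerivAt (fun t : ℝ => (p.1, t)) ((0 : ℝ), (1 : ℝ)) p.2 :=
    (hasDerivAt_const _ _).prodMk (hasDerivAt_id _)
  exact HasFDerivAt.comp_hasDerivAt (f := fun t : ℝ => (p.1, t)) (p.2 : ℝ) h.fst h1

theorem strictMono_fst_fibre (hI : IsOpen I) (hIc : I.OrdConnected) {F : ℝ × I → ℝ × I}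
    (F' : ℝ × I → ℝ × ℝ →L[ℝ] ℝ × ℝ)
    (h : ∀ p : ℝ × I, HasFDerivAt (planar F) (F' p) (p.1, (p.2 : ℝ)))
    (hpos : ∀ p, 0 < (F' p (0, 1)).1) (x : ℝ) : StrictMono fun Φ : I => (F (x, Φ)).1 := by
  have key : StrictMonoOn (fun Φ : ℝ => (planar F (x, Φ)).1) I := by
    refine strictMonoOn_of_deriv_pos hIc.convex
      (fun Φ hΦ => (hasDerivAt_fst_fibre (h (x, ⟨Φ, hΦ⟩))).continuousAt.continuousWithinAt)
      fun Φ hΦ => ?_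
    rw [hI.interior_eq] at hΦ
    rw [(hasDerivAt_fst_fibre (h (x, ⟨Φ, hΦ⟩))).deriv]
    exact hpos _
  intro Φ Φ' hlt
  have := key Φ.2 Φ'.2 hlt
  have e := fun Φ : I => congrArg Prod.fst (planar_coe F (x, Φ))
  simpa only [e] using this

theorem strictAnti_fst_fibre (hI : IsOpen I) (hIc : I.OrdConnected) {F : ℝ × I → ℝ × I}
    (F' : ℝ × I → ℝ × ℝ →L[ℝ] ℝ × ℝ)
    (h : ∀ p : ℝ × I, HasFDerivAt (planar F) (F' p) (p.1, (p.2 : ℝ)))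
    (hneg : ∀ p, (F' p (0, 1)).1 < 0) (x : ℝ) : StrictAnti fun Φ : I => (F (x, Φ)).1 := by
  have key : StrictAntiOn (fun Φ : ℝ => (planar F (x, Φ)).1) I := by
    refine strictAntiOn_of_deriv_neg hIc.convex
      (fun Φ hΦ => (hasDerivAt_fst_fibre (h (x, ⟨Φ, hΦ⟩))).continuousAt.continuousWithinAt)
      fun Φ hΦ => ?_
    rw [hI.interior_eq] at hΦ
    rw [(hasDerivAt_fst_fibre (h (x, ⟨Φ, hΦ⟩))).deriv]
    exact hneg _
  intro Φ Φ' hlt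
  have := key Φ.2 Φ'.2 hlt
  have e := fun Φ : I => congrArg Prod.fst (planar_coe F (x, Φ))
  simpa only [e] using this

end Planar

/-! ### The differential and the domain of the generating function. -/

section Differential

variable {P : ℝ} [Fact (0 < P)] {I : Set ℝ} (T : TwistMap P I)

theorem TwistMap.hasStrictFDerivAt (hI : IsOpen I) (p : ℝ × I) :
    HasStrictFDerivAt (planar T.lift) (T.differential p) (p.1, (p.2 : ℝ)) :=
  (T.contDiffOn_lift.contDiffAt ((isOpen_strip hI).mem_nhds (coe_mem_strip p))).hasStrictFDerivAt
    (by norm_num)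

theorem TwistMap.continuous_differential (hI : IsOpen I) : Continuous T.differential :=
  (T.contDiffOn_lift.continuousOn_fderiv_of_isOpen (isOpen_strip hI) (by norm_num)).comp_continuous
    (by fun_prop) coe_mem_strip

theorem TwistMap.mem_pairs (p : ℝ × I) : (p.1, (T.lift p).1) ∈ T.pairs := ⟨p, rfl⟩

/-- The twist condition makes the derivative of `(x, Φ) ↦ (x, y)` surjective, so this map is open.
-/
theorem TwistMap.isOpen_pairs (hI : IsOpen I) : IsOpen T.pairs := by
  rw [isOpen_iff_mem_nhds]
  rintro _ ⟨p, rfl⟩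
  have h := (hasStrictFDerivAt_fst (𝕜 := ℝ) (p := (p.1, (p.2 : ℝ)))).prodMk
    (T.hasStrictFDerivAt hI p).fst
  have hmap := h.map_nhds_eq_of_surj (by
    rw [LinearMap.range_eq_top]
    rintro ⟨a, b⟩
    have ht : (T.differential p (0, 1)).1 ≠ 0 := T.twist _ (coe_mem_strip p)
    set c := (T.differential p (0, 1)).1
    set d := (T.differential p (1, 0)).1 with hd
    refine ⟨(a, (b - a * d) / c), Prod.ext rfl ?_⟩
    have e : ((a, (b - a * d) / c) : ℝ × ℝ) = a • (1, 0) + ((b - a * d) / c) • (0, 1) := by simp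
    change (T.differential p (a, (b - a * d) / c)).1 = b
    rw [e, map_add, map_smul, map_smul]
    simp only [Prod.fst_add, Prod.smul_fst, smul_eq_mul, ← hd]
    change a * d + (b - a * d) / c * c = b
    field_simp
    ring)
  simp only [planar_coe] at hmap
  rw [← hmap]
  refine mem_map.2 (mem_of_superset ((isOpen_strip hI).mem_nhds (coe_mem_strip p)) ?_)
  intro q hq
  obtain ⟨p', rfl⟩ := exists_coe_eq hq
  simpa using T.mem_pairs p'

end Differential

/-! ### Orbits and the derivative cocycle. -/

section Orbits

variable {P : ℝ} [Fact (0 < P)] {I : Set ℝ} (T : TwistMap P I)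

/-- The lifted orbit of `p`. -/
def TwistMap.orbit (p : ℝ × I) (n : ℤ) : ℝ × I := (T.lift ^ n) p

@[simp] theorem TwistMap.orbit_zero (p : ℝ × I) : T.orbit p 0 = p := by
  simp [TwistMap.orbit]

theorem TwistMap.orbit_add (p : ℝ × I) (m n : ℤ) :
    T.orbit p (m + n) = T.orbit (T.orbit p m) n := by
  rw [TwistMap.orbit, add_comm, zpow_add]
  rfl

@[simp] theorem TwistMap.orbit_one (p : ℝ × I) : T.orbit p 1 = T.lift p := by
  simp [TwistMap.orbit]

theorem TwistMap.orbit_add_one (p : ℝ × I) (n : ℤ) :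
    T.orbit p (n + 1) = T.lift (T.orbit p n) := by
  rw [T.orbit_add, T.orbit_one]

theorem TwistMap.continuous_orbit (n : ℤ) : Continuous fun p => T.orbit p n :=
  (T.lift ^ n).continuous

theorem TwistMap.eq_orbit {σ : ℤ → ℝ × I} (h : ∀ n, T.lift (σ n) = σ (n + 1)) (n : ℤ) :
    σ n = T.orbit (σ 0) n := by
  induction n using Int.induction_on with
  | zero => simp
  | succ n ih => rw [T.orbit_add_one, ← ih, h]
  | pred n ih =>
    have h1 := h (-n - 1)
    rw [sub_add_cancel, ih] at h1
    have h2 := T.orbit_add_one (σ 0) (-n - 1)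
    rw [sub_add_cancel, ← h1] at h2
    exact T.lift.injective h2

theorem TwistMap.config_eq (p : ℝ × I) (n : ℤ) : T.config p n = (T.orbit p n).1 := by
  rw [TwistMap.config]
  congr 1
  refine (T.eq_orbit (σ := fun n => ((T.lift.toEquiv : Equiv.Perm (ℝ × I)) ^ n) p) (fun n => ?_)
    n).trans (by simp)
  rw [add_comm, zpow_add, zpow_one]
  rfl

theorem TwistMap.lift_orbit_fst (p : ℝ × I) (n : ℤ) :
    (T.lift (T.orbit p n)).1 = T.config p (n + 1) := by
  rw [T.config_eq, T.orbit_add_one]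

/-- The derivative along the orbit: the differential of the `n`-th iterate at `p`. -/
noncomputable def TwistMap.push (T : TwistMap P I) (p : ℝ × I) : ℕ → ℝ × ℝ →L[ℝ] ℝ × ℝ
  | 0 => ContinuousLinearMap.id ℝ _
  | n + 1 => (T.differential (T.orbit p n)).comp (T.push p n)

@[simp] theorem TwistMap.push_zero (p : ℝ × I) (v : ℝ × ℝ) : T.push p 0 v = v := rfl

theorem TwistMap.push_succ (p : ℝ × I) (n : ℕ) (v : ℝ × ℝ) :
    T.push p (n + 1) v = T.differential (T.orbit p n) (T.push p n v) := rfl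

/-- The `x`-component of the image of the downward vertical vector at `p` after `n` steps. -/
noncomputable def TwistMap.vertField (p : ℝ × I) (n : ℕ) : ℝ := (T.push p n (0, -1)).1

theorem TwistMap.continuous_push (hI : IsOpen I) (n : ℕ) (v : ℝ × ℝ) :
    Continuous fun p => T.push p n v := by
  induction n with
  | zero => exact continuous_const
  | succ n ih =>
    exact ((T.continuous_differential hI).comp (T.continuous_orbit n)).clm_apply ih

theorem TwistMap.continuous_vertField (hI : IsOpen I) (n : ℕ) :
    Continuous fun p => T.vertField p n :=
  (T.continuous_push hI n _).fst

theorem TwistMap.hasFDerivAt_pow (hI : IsOpen I) (n : ℕ) (p : ℝ × I) :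
    HasFDerivAt (planar (T.lift ^ n)) (T.push p n) (p.1, (p.2 : ℝ)) := by
  induction n with
  | zero =>
    refine (hasFDerivAt_id _).congr_of_eventuallyEq ?_
    filter_upwards [(isOpen_strip hI).mem_nhds (coe_mem_strip p)] with q hq
    exact planar_eq_self (fun p => by simp) hq
  | succ n ih =>
    have h : HasFDerivAt (planar T.lift) (T.differential (T.orbit p n))
        (planar (T.lift ^ n) (p.1, (p.2 : ℝ))) := by
      rw [planar_coe]
      exact_mod_cast (T.hasStrictFDerivAt hI (T.orbit p n)).hasFDerivAt
    refine (h.comp _ ih).congr_of_eventuallyEq ?_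
    filter_upwards [(isOpen_strip hI).mem_nhds (coe_mem_strip p)] with q hq
    rw [Function.comp_apply, ← planar_comp _ _ hq, pow_succ']
    rfl

theorem TwistMap.differentiableOn_pow_symm (n : ℕ) :
    DifferentiableOn ℝ (planar (T.lift ^ n).symm) (strip I) := by
  induction n with
  | zero =>
    exact differentiableOn_id.congr fun q hq => planar_eq_self (fun p => by
      rw [Homeomorph.symm_apply_eq]; simp) hq
  | succ n ih =>
    refine (ih.comp (T.contDiffOn_symm.differentiableOn (by norm_num))
      fun q hq => planar_mem_strip _ hq).congr fun q hq => ?_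
    rw [Function.comp_apply, ← planar_comp _ _ hq]
    congr 1
    ext1 p
    rw [Homeomorph.symm_apply_eq, pow_succ']
    simp

end Orbits

/-! ### Generating function, area form, Jacobi fields and configurations. -/

section Generating

variable {P : ℝ} [Fact (0 < P)] {I : Set ℝ} (T : TwistMap P I) (L : ℝ → ℝ → ℝ)

/-- `L₁₁` at the point of `pairs` given by `p`. -/
noncomputable def TwistMap.hess11 (p : ℝ × I) : ℝ := L11 L p.1 (T.lift p).1

/-- `L₁₂` at the point of `pairs` given by `p`. -/
noncomputable def TwistMap.hess12 (p : ℝ × I) : ℝ := L12 L p.1 (T.lift p).1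

/-- `L₂₂` at the point of `pairs` given by `p`. -/
noncomputable def TwistMap.hess22 (p : ℝ × I) : ℝ := L22 L p.1 (T.lift p).1

variable {T L}

theorem continuous_hess11 (hI : IsOpen I) (hL : IsGeneratingFunction T L) :
    Continuous (T.hess11 L) :=
  (continuousOn_L11 (T.isOpen_pairs hI) hL.contDiffOn).comp_continuous (by fun_prop) T.mem_pairs

theorem continuous_hess12 (hI : IsOpen I) (hL : IsGeneratingFunction T L) :
    Continuous (T.hess12 L) :=
  (continuousOn_L12 (T.isOpen_pairs hI) hL.contDiffOn).comp_continuous (by fun_prop) T.mem_pairs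

/-- These are the relations `Φ = -L₁(x, y)`, `Ψ = L₂(x, y)`, differentiated along `v`. Matching the
second at one point with the first at the next gives the Jacobi equation, and the common coefficient
`L₁₂` gives invariance of the area form. -/
theorem differential_relations (hI : IsOpen I) (hL : IsGeneratingFunction T L) (p : ℝ × I)
    (v : ℝ × ℝ) :
    v.2 = -(T.hess11 L p * v.1 + T.hess12 L p * (T.differential p v).1) ∧
      (T.differential p v).2 = T.hess12 L p * v.1 + T.hess22 L p * (T.differential p v).1 := by
  have hT := (T.hasStrictFDerivAt hI p).hasFDerivAt
  have hin : HasFDerivAt (fun q : ℝ × ℝ => (q.1, (planar T.lift q).1)) _ (p.1, (p.2 : ℝ)) :=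
    (hasFDerivAt_fst (𝕜 := ℝ)).prodMk hT.fst
  have hval : ((p.1, (planar T.lift (p.1, (p.2 : ℝ))).1) : ℝ × ℝ) = (p.1, (T.lift p).1) := by
    rw [planar_coe]
  have hU := T.isOpen_pairs hI
  have h1 := hasFDerivAt_d1 hU hL.contDiffOn (T.mem_pairs p)
  have h2 := hasFDerivAt_d2 hU hL.contDiffOn (T.mem_pairs p)
  rw [← hval] at h1 h2
  have c1 := HasFDerivAt.comp (f := fun q : ℝ × ℝ => (q.1, (planar T.lift q).1)) _ h1 hin
  have c2 := HasFDerivAt.comp (f := fun q : ℝ × ℝ => (q.1, (planar T.lift q).1)) _ h2 hin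
  have hs := (isOpen_strip hI).mem_nhds (coe_mem_strip p)
  have e1 := c1.unique ((hasFDerivAt_snd (𝕜 := ℝ)).neg.congr_of_eventuallyEq (by
    filter_upwards [hs] with q hq
    obtain ⟨p', rfl⟩ := exists_coe_eq hq
    simp only [Function.comp_apply, planar_coe]
    rw [hL.fst_eq p']
    exact (neg_neg _).symm))
  have e2 := c2.unique (hT.snd.congr_of_eventuallyEq (by
    filter_upwards [hs] with q hq
    obtain ⟨p', rfl⟩ := exists_coe_eq hq
    simp [hL.snd_eq p']))
  have e1' := DFunLike.congr_fun e1 v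
  have e2' := DFunLike.congr_fun e2 v
  simp at e1' e2'
  simp only [TwistMap.hess11, TwistMap.hess12, TwistMap.hess22]
  exact ⟨by linarith, e2'.symm⟩

/-- The area form. -/
def wedge (v w : ℝ × ℝ) : ℝ := v.1 * w.2 - v.2 * w.1

theorem wedge_differential (hI : IsOpen I) (hL : IsGeneratingFunction T L) (p : ℝ × I)
    (v w : ℝ × ℝ) : wedge (T.differential p v) (T.differential p w) = wedge v w := by
  obtain ⟨h1, h2⟩ := differential_relations hI hL p v
  obtain ⟨h3, h4⟩ := differential_relations hI hL p w
  rw [wedge, wedge, h2, h4, h1, h3]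
  ring

theorem wedge_push (hI : IsOpen I) (hL : IsGeneratingFunction T L) (p : ℝ × I) (n : ℕ)
    (v w : ℝ × ℝ) : wedge (T.push p n v) (T.push p n w) = wedge v w := by
  induction n with
  | zero => rfl
  | succ n ih => rw [T.push_succ, T.push_succ, wedge_differential hI hL, ih]

/-- The Wronskian of the `x`-components of two invariant vector fields along an orbit. -/
theorem wronskian_push (hI : IsOpen I) (hL : IsGeneratingFunction T L) (p : ℝ × I) (n : ℕ)
    (v w : ℝ × ℝ) :
    T.hess12 L (T.orbit p n) * ((T.push p (n + 1) v).1 * (T.push p n w).1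
      - (T.push p n v).1 * (T.push p (n + 1) w).1) = wedge v w := by
  rw [← wedge_push hI hL p n]
  obtain ⟨h1, -⟩ := differential_relations hI hL (T.orbit p n) (T.push p n v)
  obtain ⟨h3, -⟩ := differential_relations hI hL (T.orbit p n) (T.push p n w)
  rw [wedge, h1, h3, T.push_succ, T.push_succ]
  ring

theorem push_jacobi (hI : IsOpen I) (hL : IsGeneratingFunction T L) (p : ℝ × I) (n : ℕ)
    (v : ℝ × ℝ) :
    T.hess12 L (T.orbit p n) * (T.push p n v).1
      + (T.hess22 L (T.orbit p n) + T.hess11 L (T.orbit p (n + 1))) * (T.push p (n + 1) v).1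
      + T.hess12 L (T.orbit p (n + 1)) * (T.push p (n + 2) v).1 = 0 := by
  obtain ⟨-, h2⟩ := differential_relations hI hL (T.orbit p n) (T.push p n v)
  obtain ⟨h3, -⟩ := differential_relations hI hL (T.orbit p (n + 1)) (T.push p (n + 1) v)
  rw [← T.push_succ] at h2
  have e : T.push p (n + 2) v = T.differential (T.orbit p (n + 1)) (T.push p (n + 1) v) := by
    rw [T.push_succ p (n + 1)]
    push_cast
    rfl
  rw [← e] at h3
  linarith

theorem vertField_zero (p : ℝ × I) : T.vertField p 0 = 0 := rfl

theorem vertField_one (hI : IsOpen I) (hL : IsGeneratingFunction T L) (p : ℝ × I) :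
    T.hess12 L p * T.vertField p 1 = 1 := by
  have h := (differential_relations hI hL p (0, -1)).1
  have e : T.vertField p 1 = (T.differential p (0, -1)).1 := by
    rw [TwistMap.vertField, T.push_succ]
    simp
  rw [e]
  simp at h
  linarith

theorem isJacobiField_config_iff (p : ℝ × I) (ξ : ℤ → ℝ) :
    IsJacobiField L (T.config p) ξ ↔ ∀ n : ℤ, T.hess12 L (T.orbit p n) * ξ n
      + (T.hess22 L (T.orbit p n) + T.hess11 L (T.orbit p (n + 1))) * ξ (n + 1)
      + T.hess12 L (T.orbit p (n + 1)) * ξ (n + 2) = 0 := by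
  simp only [TwistMap.hess11, TwistMap.hess12, TwistMap.hess22, T.lift_orbit_fst, ← T.config_eq]
  constructor
  · intro h n
    have := h (n + 1)
    rwa [add_sub_cancel_right, show ξ (n + 1 + 1) = ξ (n + 2) by rw [add_assoc]; norm_num] at this
  · intro h n
    have := h (n - 1)
    rwa [sub_add_cancel, show n - 1 + 2 = n + 1 by ring] at this

theorem exists_orbit_of_isConfiguration (hL : IsGeneratingFunction T L) {x : ℤ → ℝ}
    (hx : IsConfiguration T L x) : ∃ p, x = T.config p := by
  obtain ⟨hU, hE⟩ := hx
  choose σ hσ using hU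
  simp only [Prod.mk.injEq] at hσ
  have h : ∀ n, T.lift (σ n) = σ (n + 1) := fun n => by
    refine Prod.ext ((hσ n).2.trans (hσ (n + 1)).1.symm) (Subtype.ext ?_)
    rw [hL.snd_eq, hL.fst_eq, (hσ n).1, (hσ n).2, (hσ (n + 1)).1, (hσ (n + 1)).2]
    have := hE (n + 1)
    rw [add_sub_cancel_right] at this
    linarith
  refine ⟨σ 0, funext fun n => ?_⟩
  rw [T.config_eq, ← T.eq_orbit h, (hσ n).1]

theorem isConfiguration_config (hL : IsGeneratingFunction T L) (p : ℝ × I) :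
    IsConfiguration T L (T.config p) := by
  refine ⟨fun n => ?_, fun n => ?_⟩
  · rw [← T.lift_orbit_fst, T.config_eq]
    exact T.mem_pairs _
  · have h1 := hL.snd_eq (T.orbit p (n - 1))
    have h2 := hL.fst_eq (T.orbit p n)
    rw [← T.orbit_add_one, ← T.config_eq] at h1
    rw [T.lift_orbit_fst] at h2
    simp only [sub_add_cancel, ← T.config_eq] at h1 h2
    linarith

end Generating

/-! ### Propagation of the sign of the vertical field. -/

section Sign

variable {P : ℝ} [Fact (0 < P)] {I : Set ℝ} {T : TwistMap P I} {L : ℝ → ℝ → ℝ}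

theorem lift_pow_translate (n : ℕ) (x : ℝ) (Φ : I) :
    (T.lift ^ n) (x + P, Φ) = (((T.lift ^ n) (x, Φ)).1 + P, ((T.lift ^ n) (x, Φ)).2) := by
  induction n with
  | zero => simp
  | succ n ih => rw [pow_succ', Homeomorph.mul_apply, ih, T.lift_translate]; rfl

theorem push_vertical (p : ℝ × I) (n : ℕ) : (T.push p n (0, 1)).1 = -T.vertField p n := by
  rw [TwistMap.vertField, show ((0, -1) : ℝ × ℝ) = -(0, 1) by simp, map_neg]
  simp

/-- Invariance of the area form identifies the twist of the inverse with `vertField`: pairing the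
vertical vector at the source with the pullback `E (0, 1)` of the vertical vector at the target
gives `(E (0, 1)).1 = T.vertField p' n`. -/
theorem isNegTwist_pow (hI : IsOpen I) (hIc : I.OrdConnected) (hL : IsGeneratingFunction T L)
    (n : ℕ) (hpos : ∀ p, 0 < T.vertField p n) : IsNegTwist P (T.lift ^ n) where
  translate := lift_pow_translate n
  anti := strictAnti_fst_fibre hI hIc (fun p => T.push p n) (T.hasFDerivAt_pow hI n) fun p => by
    rw [push_vertical]
    linarith [hpos p]
  mono_symm := by
    have hd : ∀ p : ℝ × I, HasFDerivAt (planar (T.lift ^ n).symm)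
        (fderiv ℝ (planar (T.lift ^ n).symm) (p.1, (p.2 : ℝ))) (p.1, (p.2 : ℝ)) := fun p =>
      ((T.differentiableOn_pow_symm n).differentiableAt
        ((isOpen_strip hI).mem_nhds (coe_mem_strip p))).hasFDerivAt
    refine strictMono_fst_fibre hI hIc _ hd fun p => ?_
    set p' := (T.lift ^ n).symm p
    set E := fderiv ℝ (planar (T.lift ^ n).symm) (p.1, (p.2 : ℝ))
    have h1 : HasFDerivAt (planar (T.lift ^ n)) (T.push p' n)
        (planar (T.lift ^ n).symm (p.1, (p.2 : ℝ))) := by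
      rw [planar_coe]
      exact T.hasFDerivAt_pow hI n p'
    have h2 := (h1.comp _ (hd p)).unique ((hasFDerivAt_id _).congr_of_eventuallyEq (by
      filter_upwards [(isOpen_strip hI).mem_nhds (coe_mem_strip p)] with q hq
      rw [Function.comp_apply, ← planar_comp _ _ hq, planar_eq_self (fun p => by simp) hq]
      rfl))
    have h3 : T.push p' n (E (0, 1)) = (0, 1) := DFunLike.congr_fun h2 (0, 1)
    have h4 := wedge_push hI hL p' n (0, -1) (E (0, 1))
    rw [h3] at h4
    simp only [wedge] at h4
    have h5 := hpos p'
    rw [TwistMap.vertField] at h5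
    linarith

/-- If the images of the vertical vector after `n` steps all point in one direction, then so do
the images after `n + 1` steps, provided these are never vertical. -/
theorem vertField_succ_pos (hI : IsOpen I) (hIc : I.OrdConnected) (hIn : I.Nonempty)
    (hL : IsGeneratingFunction T L) (n : ℕ) (hone : ∀ p, 0 < T.vertField p 1)
    (hpos : ∀ p, 0 < T.vertField p n) (hne : ∀ p, T.vertField p (n + 1) ≠ 0) (p : ℝ × I) :
    0 < T.vertField p (n + 1) := by
  by_contra! hp
  have hP : 0 < P := Fact.out
  have hall : ∀ q, T.vertField q (n + 1) < 0 := by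
    intro q
    by_contra! hq
    have : PreconnectedSpace I := Subtype.preconnectedSpace hIc.isPreconnected
    obtain ⟨r, -, hr⟩ := (isPreconnected_univ (α := ℝ × I)).intermediate_value
      (mem_univ p) (mem_univ q) (T.continuous_vertField hI (n + 1)).continuousOn ⟨hp, hq⟩
    exact hne r hr
  have : Nonempty I := hIn.to_subtype
  -- The conditionally complete order on the subtype `I` needs a default element for sets without a
  -- supremum in `I`.
  let _ : Inhabited I := Classical.inhabited_of_nonempty this
  have hnhds : ∀ Φ : I, ∃ l u, (Φ : ℝ) ∈ Ioo l u ∧ Ioo l u ⊆ I := fun Φ =>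
    mem_nhds_iff_exists_Ioo_subset.1 (hI.mem_nhds Φ.2)
  have : NoMinOrder I := ⟨fun Φ => by
    obtain ⟨l, u, hm, hs⟩ := hnhds Φ
    obtain ⟨c, hc⟩ := exists_between hm.1
    exact ⟨⟨c, hs ⟨hc.1, hc.2.trans hm.2⟩⟩, hc.2⟩⟩
  have : NoMaxOrder I := ⟨fun Φ => by
    obtain ⟨l, u, hm, hs⟩ := hnhds Φ
    obtain ⟨c, hc⟩ := exists_between hm.2
    exact ⟨⟨c, hs ⟨hm.1.trans hc.1, hc.2⟩⟩, hc.1⟩⟩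
  have hA := isNegTwist_pow hI hIc hL n hpos
  have hB := isNegTwist_pow hI hIc hL 1 hone
  refine hA.not_strictMono_comp hP hB p.1 ?_
  have hmono := strictMono_fst_fibre hI hIc (fun p => T.push p (n + 1))
    (T.hasFDerivAt_pow hI (n + 1)) (fun q => by
      rw [push_vertical]
      linarith [hall q]) p.1
  rw [pow_one]
  rw [pow_succ'] at hmono
  exact hmono

end Sign

/-! ### Bi-infinite solutions of second-order recurrences. -/

section Recurrence

theorem exists_int_sequence {α : Type*} (e : ℤ → α ≃ α) (a : α) :
    ∃ σ : ℤ → α, σ 0 = a ∧ ∀ n, σ (n + 1) = e n (σ n) := by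
  let f : ℕ → α := fun n => Nat.rec a (fun k s => e k s) n
  let g : ℕ → α := fun n => Nat.rec a (fun k s => (e (-k - 1)).symm s) n
  let σ : ℤ → α := fun n => if 0 ≤ n then f n.toNat else g (-n).toNat
  have hf : ∀ n : ℕ, σ n = f n := fun n => by simp [σ]
  have hg : ∀ n : ℕ, σ (-n) = g n := fun n => by
    rcases n with _ | n
    · simp [σ, f, g]
    · have : ¬ (0 : ℤ) ≤ -((n + 1 : ℕ) : ℤ) := by push_cast; omega
      simp only [σ, if_neg this, neg_neg, Int.toNat_natCast]
  refine ⟨σ, hf 0, fun n => ?_⟩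
  induction n using Int.induction_on with
  | zero =>
    rw [show (0 : ℤ) + 1 = ((1 : ℕ) : ℤ) by simp, hf, show (0 : ℤ) = ((0 : ℕ) : ℤ) by simp, hf]
    rfl
  | succ n _ =>
    rw [show (n : ℤ) + 1 = ((n + 1 : ℕ) : ℤ) by simp,
      show ((n + 1 : ℕ) : ℤ) + 1 = ((n + 2 : ℕ) : ℤ) by push_cast; ring, hf, hf]
  | pred n _ =>
    rw [sub_add_cancel, hg, show -(n : ℤ) - 1 = -((n + 1 : ℕ) : ℤ) by push_cast; ring, hg]
    change _ = e _ ((e (-n - 1)).symm (g n))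
    rw [show -((n + 1 : ℕ) : ℤ) = -(n : ℤ) - 1 by push_cast; ring, Equiv.apply_symm_apply]

theorem exists_solution_recurrence (b a : ℤ → ℝ) (hb : ∀ n, b n ≠ 0) (u w : ℝ) :
    ∃ ξ : ℤ → ℝ, ξ 0 = u ∧ ξ 1 = w ∧
      ∀ n, b n * ξ n + a n * ξ (n + 1) + b (n + 1) * ξ (n + 2) = 0 := by
  let e : ℤ → ℝ × ℝ ≃ ℝ × ℝ := fun n =>
    { toFun := fun s => (s.2, -(b n * s.1 + a n * s.2) / b (n + 1))
      invFun := fun s => (-(a n * s.1 + b (n + 1) * s.2) / b n, s.1)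
      left_inv := fun s => by
        have := hb n
        have := hb (n + 1)
        ext <;> simp
        field_simp
        ring
      right_inv := fun s => by
        have := hb n
        have := hb (n + 1)
        ext <;> simp
        field_simp
        ring }
  obtain ⟨σ, h0, h⟩ := exists_int_sequence e (u, w)
  have h1 : ∀ n, (σ (n + 1)).1 = (σ n).2 := fun n => by rw [h]; rfl
  refine ⟨fun n => (σ n).1, by simp [h0], ?_, fun n => ?_⟩
  · have := h1 0
    simp only [zero_add] at this
    simp [this, h0]
  · have h2 : (σ (n + 2)).1 = -(b n * (σ n).1 + a n * (σ n).2) / b (n + 1) := by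
      rw [show n + 2 = n + 1 + 1 by ring, h1, h]
      rfl
    simp only [h1, h2]
    have := hb (n + 1)
    field_simp
    ring

end Recurrence

/-! ### Absence of conjugate points makes the vertical fields positive. -/

section NoConjugatePoints

variable {P : ℝ} [Fact (0 < P)] {I : Set ℝ} {T : TwistMap P I} {L : ℝ → ℝ → ℝ}

theorem hess12_pos (hL12 : ∀ q ∈ T.pairs, 0 < L12 L q.1 q.2) (p : ℝ × I) : 0 < T.hess12 L p :=
  hL12 _ (T.mem_pairs p)

theorem vertField_one_pos (hI : IsOpen I) (hL : IsGeneratingFunction T L)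
    (hL12 : ∀ q ∈ T.pairs, 0 < L12 L q.1 q.2) (p : ℝ × I) : 0 < T.vertField p 1 := by
  have h := vertField_one hI hL p
  exact pos_of_mul_pos_right (h.symm ▸ one_pos) (hess12_pos hL12 p).le

theorem vertField_jacobi (hI : IsOpen I) (hL : IsGeneratingFunction T L) (p : ℝ × I) (n : ℕ) :
    T.hess12 L (T.orbit p n) * T.vertField p n
      + (T.hess22 L (T.orbit p n) + T.hess11 L (T.orbit p (n + 1))) * T.vertField p (n + 1)
      + T.hess12 L (T.orbit p (n + 1)) * T.vertField p (n + 2) = 0 :=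
  push_jacobi hI hL p n _

/-- The bi-infinite Jacobi field with initial values `0` and `T.vertField p 1` agrees with
`T.vertField p` at nonnegative times, so a later zero of the latter is conjugate to time `0`. -/
theorem vertField_ne_zero (hI : IsOpen I) (hL : IsGeneratingFunction T L)
    (hL12 : ∀ q ∈ T.pairs, 0 < L12 L q.1 q.2) {p : ℝ × I}
    (h : NoConjugatePoints L (T.config p)) (n : ℕ) : T.vertField p (n + 1) ≠ 0 := by
  intro h0
  obtain ⟨ξ, hξ0, hξ1, hξ⟩ := exists_solution_recurrence (fun n => T.hess12 L (T.orbit p n))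
    (fun n => T.hess22 L (T.orbit p n) + T.hess11 L (T.orbit p (n + 1)))
    (fun n => (hess12_pos hL12 _).ne') 0 (T.vertField p 1)
  have key : ∀ k : ℕ, ξ k = T.vertField p k ∧ ξ (k + 1) = T.vertField p (k + 1) := by
    intro k
    induction k with
    | zero => exact ⟨hξ0, by simpa using hξ1⟩
    | succ k ih =>
      refine ⟨by push_cast; exact ih.2, ?_⟩
      have h1 := hξ k
      have h2 := vertField_jacobi hI hL p k
      rw [ih.1, ih.2, ← h2] at h1
      have h3 := mul_left_cancel₀ (hess12_pos hL12 _).ne' (add_left_cancel h1)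
      push_cast
      rw [add_assoc]
      exact h3
  refine h 0 (n + 1 : ℕ) (by push_cast; omega)
    ⟨ξ, (isJacobiField_config_iff p ξ).2 hξ, fun hz => ?_, hξ0, ?_⟩
  · have := vertField_one_pos hI hL hL12 p
    rw [← hξ1, hz] at this
    exact lt_irrefl _ this
  · rw [(key (n + 1)).1, h0]

theorem vertField_pos_of_noConjugatePoints (hI : IsOpen I) (hIc : I.OrdConnected)
    (hIn : I.Nonempty) (hL : IsGeneratingFunction T L)
    (hL12 : ∀ q ∈ T.pairs, 0 < L12 L q.1 q.2)
    (h : ∀ x : ℤ → ℝ, IsConfiguration T L x → NoConjugatePoints L x) (n : ℕ) (p : ℝ × I) :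
    0 < T.vertField p (n + 1) := by
  induction n generalizing p with
  | zero => exact vertField_one_pos hI hL hL12 p
  | succ n ih =>
    exact vertField_succ_pos hI hIc hIn hL (n + 1) (vertField_one_pos hI hL hL12) ih
      (fun q => vertField_ne_zero hI hL hL12 (h _ (isConfiguration_config hL q)) _) p

end NoConjugatePoints

/-! ### First and second variation of the action. -/

section Variation

/-- The action of the segment `X 0, …, X n`. -/
def segAction (L : ℝ → ℝ → ℝ) (n : ℕ) (X : ℕ → ℝ) : ℝ :=
  ∑ i ∈ Finset.range n, L (X i) (X (i + 1))

/-- The first variation of the action of the segment `X 0, …, X n` in the direction `h`. -/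
noncomputable def firstVar (L : ℝ → ℝ → ℝ) (n : ℕ) (X h : ℕ → ℝ) : ℝ :=
  ∑ i ∈ Finset.range n,
    (d1 L (X i) (X (i + 1)) * h i + d2 L (X i) (X (i + 1)) * h (i + 1))

/-- The second variation of the action of the segment `X 0, …, X n` in the direction `h`. -/
noncomputable def secondVar (L : ℝ → ℝ → ℝ) (n : ℕ) (X h : ℕ → ℝ) : ℝ :=
  ∑ i ∈ Finset.range n,
    ((L11 L (X i) (X (i + 1)) * h i + L12 L (X i) (X (i + 1)) * h (i + 1)) * h i
      + (L12 L (X i) (X (i + 1)) * h i + L22 L (X i) (X (i + 1)) * h (i + 1)) * h (i + 1))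

variable {L : ℝ → ℝ → ℝ} {U : Set (ℝ × ℝ)}

theorem action_eq_segAction (M N : ℤ) (x : ℤ → ℝ) :
    action L M N x = segAction L (N - M).toNat fun i => x (M + i) := by
  rw [action, segAction, show Finset.Ico M N = (Finset.range (N - M).toNat).map
    (Nat.castEmbedding.trans (addLeftEmbedding M)) from rfl, Finset.sum_map]
  refine Finset.sum_congr rfl fun i _ => ?_
  simp [add_assoc]

theorem hasDerivAt_segAction (hU : IsOpen U)
    (hL : ContDiffOn ℝ 2 (fun q : ℝ × ℝ => L q.1 q.2) U) {n : ℕ} {X h : ℕ → ℝ} {t : ℝ}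
    (hX : ∀ i < n, (X i + t * h i, X (i + 1) + t * h (i + 1)) ∈ U) :
    HasDerivAt (fun t => segAction L n fun i => X i + t * h i)
      (firstVar L n (fun i => X i + t * h i) h) t := by
  refine HasDerivAt.fun_sum fun i hi => ?_
  have hc : ∀ i, HasDerivAt (fun t => X i + t * h i) (h i) t := fun i => by
    simpa using ((hasDerivAt_id t).mul_const (h i)).const_add (X i)
  have := HasFDerivAt.comp_hasDerivAt
    (f := fun t => (X i + t * h i, X (i + 1) + t * h (i + 1))) t
    (hasFDerivAt_of_contDiffOn hU hL (hX i (Finset.mem_range.1 hi))) ((hc i).prodMk (hc (i + 1)))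
  rw [linForm_apply] at this
  exact this

theorem hasDerivAt_firstVar (hU : IsOpen U)
    (hL : ContDiffOn ℝ 2 (fun q : ℝ × ℝ => L q.1 q.2) U) {n : ℕ} {X h : ℕ → ℝ} {t : ℝ}
    (hX : ∀ i < n, (X i + t * h i, X (i + 1) + t * h (i + 1)) ∈ U) :
    HasDerivAt (fun t => firstVar L n (fun i => X i + t * h i) h)
      (secondVar L n (fun i => X i + t * h i) h) t := by
  refine HasDerivAt.fun_sum fun i hi => ?_
  have hc : ∀ i, HasDerivAt (fun t => X i + t * h i) (h i) t := fun i => by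
    simpa using ((hasDerivAt_id t).mul_const (h i)).const_add (X i)
  have h1 := HasFDerivAt.comp_hasDerivAt
    (f := fun t => (X i + t * h i, X (i + 1) + t * h (i + 1))) t
    (hasFDerivAt_d1 hU hL (hX i (Finset.mem_range.1 hi))) ((hc i).prodMk (hc (i + 1)))
  have h2 := HasFDerivAt.comp_hasDerivAt
    (f := fun t => (X i + t * h i, X (i + 1) + t * h (i + 1))) t
    (hasFDerivAt_d2 hU hL (hX i (Finset.mem_range.1 hi))) ((hc i).prodMk (hc (i + 1)))
  rw [linForm_apply] at h1 h2
  exact (h1.mul_const (h i)).add (h2.mul_const (h (i + 1)))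

theorem sum_add_shift (f g : ℕ → ℝ) (m : ℕ) :
    ∑ i ∈ Finset.range (m + 1), (f i + g i)
      = f 0 + ∑ i ∈ Finset.range m, (g i + f (i + 1)) + g m := by
  rw [Finset.sum_add_distrib, Finset.sum_range_succ', Finset.sum_range_succ g,
    Finset.sum_add_distrib]
  ring

theorem firstVar_eq_zero {n : ℕ} {X h : ℕ → ℝ}
    (hX : ∀ i, d2 L (X i) (X (i + 1)) + d1 L (X (i + 1)) (X (i + 2)) = 0)
    (h0 : h 0 = 0) (hn : h n = 0) : firstVar L n X h = 0 := by
  rcases n with _ | m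
  · simp [firstVar]
  · rw [firstVar, sum_add_shift (fun i => d1 L (X i) (X (i + 1)) * h i)
      (fun i => d2 L (X i) (X (i + 1)) * h (i + 1)), h0, hn]
    simp only [mul_zero, zero_add, add_zero]
    refine Finset.sum_eq_zero fun i _ => ?_
    rw [← add_mul, add_assoc, one_add_one_eq_two, hX, zero_mul]

/-- A tridiagonal quadratic form with positive off-diagonal entries that has a positive
supersolution is negative semidefinite. -/
theorem tridiagonal_nonpos {A B C ξ h : ℕ → ℝ} {n : ℕ} (hB : ∀ i < n, 0 < B i)
    (hξ : ∀ i ≤ n, 0 < ξ i)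
    (hJ : ∀ i, i + 1 < n →
      B i * ξ i + (C i + A (i + 1)) * ξ (i + 1) + B (i + 1) * ξ (i + 2) ≤ 0)
    (h0 : h 0 = 0) (hn : h n = 0) :
    ∑ i ∈ Finset.range n, ((A i * h i + B i * h (i + 1)) * h i
      + (B i * h i + C i * h (i + 1)) * h (i + 1)) ≤ 0 := by
  rcases n with _ | m
  · simp
  -- Each cross term `2 * B i * h i * h (i + 1)` is bounded by squares with weights `ξ (i + 1) / ξ
  -- i` and its inverse. After regrouping by site, the coefficient of `h (i + 1) ^ 2` is the left
  -- side of `hJ` divided by `ξ (i + 1)`.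
  set f : ℕ → ℝ := fun i => (A i + B i * ξ (i + 1) / ξ i) * h i ^ 2 with hf
  set g : ℕ → ℝ := fun i => (C i + B i * ξ i / ξ (i + 1)) * h (i + 1) ^ 2 with hg
  calc _ ≤ ∑ i ∈ Finset.range (m + 1), (f i + g i) := by
        refine Finset.sum_le_sum fun i hi => ?_
        rw [Finset.mem_range] at hi
        have hb := hB i hi
        have h1 := hξ i hi.le
        have h2 := hξ (i + 1) hi
        have key : f i + g i - ((A i * h i + B i * h (i + 1)) * h i
            + (B i * h i + C i * h (i + 1)) * h (i + 1))
            = B i * (ξ (i + 1) * h i - ξ i * h (i + 1)) ^ 2 / (ξ i * ξ (i + 1)) := by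
          simp only [hf, hg]
          field_simp
          ring
        have : 0 ≤ B i * (ξ (i + 1) * h i - ξ i * h (i + 1)) ^ 2 / (ξ i * ξ (i + 1)) := by
          positivity
        linarith
    _ = f 0 + ∑ i ∈ Finset.range m, (g i + f (i + 1)) + g m := sum_add_shift f g m
    _ ≤ 0 := by
        have hf0 : f 0 = 0 := by simp [hf, h0]
        have hgm : g m = 0 := by simp [hg, hn]
        rw [hf0, hgm, zero_add, add_zero]
        refine Finset.sum_nonpos fun i hi => ?_
        rw [Finset.mem_range] at hi
        have h1 := hξ (i + 1) (by omega)
        have key : g i + f (i + 1) = (B i * ξ i + (C i + A (i + 1)) * ξ (i + 1)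
            + B (i + 1) * ξ (i + 2)) * h (i + 1) ^ 2 / ξ (i + 1) := by
          simp only [hf, hg]
          field_simp
          ring
        rw [key]
        exact div_nonpos_of_nonpos_of_nonneg
          (mul_nonpos_of_nonpos_of_nonneg (hJ i (by omega)) (sq_nonneg _)) h1.le

theorem le_of_second_deriv_nonpos {φ φ₁ φ₂ : ℝ → ℝ}
    (h1 : ∀ t ∈ Icc (0 : ℝ) 1, HasDerivAt φ (φ₁ t) t)
    (h2 : ∀ t ∈ Icc (0 : ℝ) 1, HasDerivAt φ₁ (φ₂ t) t)
    (h0 : φ₁ 0 = 0) (hneg : ∀ t ∈ Icc (0 : ℝ) 1, φ₂ t ≤ 0) : φ 1 ≤ φ 0 := by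
  have hzero : (0 : ℝ) ∈ Icc (0 : ℝ) 1 := ⟨le_rfl, zero_le_one⟩
  have hone : (1 : ℝ) ∈ Icc (0 : ℝ) 1 := ⟨zero_le_one, le_rfl⟩
  have hanti : AntitoneOn φ₁ (Icc 0 1) :=
    antitoneOn_of_deriv_nonpos (convex_Icc 0 1)
      (fun t ht => (h2 t ht).continuousAt.continuousWithinAt)
      (fun t ht => (h2 t (interior_subset ht)).differentiableAt.differentiableWithinAt)
      fun t ht => by rw [(h2 t (interior_subset ht)).deriv]; exact hneg t (interior_subset ht)
  refine antitoneOn_of_deriv_nonpos (convex_Icc 0 1)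
      (fun t ht => (h1 t ht).continuousAt.continuousWithinAt)
      (fun t ht => (h1 t (interior_subset ht)).differentiableAt.differentiableWithinAt)
      (fun t ht => ?_) hzero hone zero_le_one
  rw [(h1 t (interior_subset ht)).deriv, ← h0]
  exact hanti hzero (interior_subset ht) (interior_subset ht).1

/-- Subtract from `u` a small multiple of a solution of the equation with right side `1`. The strict
inequality, unlike the Jacobi equation, survives a small change of the underlying segment. -/
theorem exists_strict_supersolution {b a u : ℕ → ℝ} (hb : ∀ i, b i ≠ 0)
    (hu : ∀ i, b i * u i + a i * u (i + 1) + b (i + 1) * u (i + 2) = 0) (n : ℕ)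
    (hpos : ∀ i ≤ n, 0 < u i) :
    ∃ ξ : ℕ → ℝ, (∀ i ≤ n, 0 < ξ i) ∧
      ∀ i, b i * ξ i + a i * ξ (i + 1) + b (i + 1) * ξ (i + 2) < 0 := by
  let σ : ℕ → ℝ × ℝ := fun n => Nat.rec (0, 0)
    (fun k s => (s.2, (1 - b k * s.1 - a k * s.2) / b (k + 1))) n
  have h2 : ∀ i, b i * (σ i).1 + a i * (σ (i + 1)).1 + b (i + 1) * (σ (i + 2)).1 = 1 := by
    intro i
    change b i * (σ i).1 + a i * (σ i).2
      + b (i + 1) * ((1 - b i * (σ i).1 - a i * (σ i).2) / b (i + 1)) = 1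
    have := hb (i + 1)
    field_simp
    ring
  have hev : ∀ᶠ δ in 𝓝[>] (0 : ℝ), ∀ i ∈ Finset.range (n + 1), 0 < u i - δ * (σ i).1 := by
    rw [Finset.eventually_all]
    intro i hi
    have hc : Continuous fun δ : ℝ => u i - δ * (σ i).1 := by fun_prop
    have h0 : 0 < u i - 0 * (σ i).1 := by
      simpa using hpos i (by rw [Finset.mem_range] at hi; omega)
    exact nhdsWithin_le_nhds ((hc.tendsto 0).eventually (eventually_gt_nhds h0))
  obtain ⟨δ, hδ, hδ0⟩ := (hev.and self_mem_nhdsWithin).exists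
  refine ⟨fun i => u i - δ * (σ i).1, fun i hi => hδ i (by rw [Finset.mem_range]; omega),
    fun i => ?_⟩
  have e : b i * (u i - δ * (σ i).1) + a i * (u (i + 1) - δ * (σ (i + 1)).1)
      + b (i + 1) * (u (i + 2) - δ * (σ (i + 2)).1) = -δ := by
    linear_combination hu i - δ * h2 i
  rw [e]
  exact neg_lt_zero.2 hδ0

theorem eventually_small_pair {a b : ℝ} {Q : ℝ × ℝ → Prop} (h : ∀ᶠ q in 𝓝 (a, b), Q q) :
    ∀ᶠ ε in 𝓝[>] (0 : ℝ), ∀ y z, |y - a| < ε → |z - b| < ε → Q (y, z) := by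
  obtain ⟨ε₀, hε₀, hQ⟩ := Metric.eventually_nhds_iff.1 h
  filter_upwards [Ioo_mem_nhdsGT hε₀] with ε hε y z hy hz
  refine hQ (max_lt ?_ ?_)
  · exact (Real.dist_eq y a).trans_lt (hy.trans hε.2)
  · exact (Real.dist_eq z b).trans_lt (hz.trans hε.2)

theorem eventually_small_triple {a b c : ℝ} {Q : ℝ × ℝ × ℝ → Prop}
    (h : ∀ᶠ q in 𝓝 (a, b, c), Q q) :
    ∀ᶠ ε in 𝓝[>] (0 : ℝ), ∀ y z w, |y - a| < ε → |z - b| < ε → |w - c| < ε → Q (y, z, w) := by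
  obtain ⟨ε₀, hε₀, hQ⟩ := Metric.eventually_nhds_iff.1 h
  filter_upwards [Ioo_mem_nhdsGT hε₀] with ε hε y z w hy hz hw
  refine hQ (max_lt ?_ (max_lt ?_ ?_))
  · exact (Real.dist_eq y a).trans_lt (hy.trans hε.2)
  · exact (Real.dist_eq z b).trans_lt (hz.trans hε.2)
  · exact (Real.dist_eq w c).trans_lt (hw.trans hε.2)

/-- An extremal segment with a positive Jacobi field is a local maximum of the action. -/
theorem exists_segAction_le (hU : IsOpen U)
    (hL : ContDiffOn ℝ 2 (fun q : ℝ × ℝ => L q.1 q.2) U)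
    (hL12 : ∀ q ∈ U, 0 < L12 L q.1 q.2) {X u : ℕ → ℝ} (hXU : ∀ i, (X i, X (i + 1)) ∈ U)
    (hX : ∀ i, d2 L (X i) (X (i + 1)) + d1 L (X (i + 1)) (X (i + 2)) = 0)
    (hu : ∀ i, L12 L (X i) (X (i + 1)) * u i
      + (L22 L (X i) (X (i + 1)) + L11 L (X (i + 1)) (X (i + 2))) * u (i + 1)
      + L12 L (X (i + 1)) (X (i + 2)) * u (i + 2) = 0) (n : ℕ) (hpos : ∀ i ≤ n, 0 < u i) :
    ∃ ε > 0, ∀ y : ℕ → ℝ, y 0 = X 0 → y n = X n → (∀ i ≤ n, |y i - X i| < ε) →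
      segAction L n y ≤ segAction L n X := by
  obtain ⟨ξ, hξ, hJ⟩ := exists_strict_supersolution
    (fun i => (hL12 _ (hXU i)).ne') hu n hpos
  have hev1 : ∀ᶠ ε in 𝓝[>] (0 : ℝ), ∀ i ∈ Finset.range n, ∀ y z, |y - X i| < ε →
      |z - X (i + 1)| < ε → (y, z) ∈ U := by
    rw [Finset.eventually_all]
    exact fun i _ => eventually_small_pair (hU.mem_nhds (hXU i))
  have hev2 : ∀ᶠ ε in 𝓝[>] (0 : ℝ), ∀ i ∈ Finset.range n, ∀ y z w, |y - X i| < ε →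
      |z - X (i + 1)| < ε → |w - X (i + 2)| < ε →
      L12 L y z * ξ i + (L22 L y z + L11 L z w) * ξ (i + 1) + L12 L z w * ξ (i + 2) < 0 := by
    rw [Finset.eventually_all]
    intro i _
    have hp1 : Tendsto (fun q : ℝ × ℝ × ℝ => (q.1, q.2.1)) (𝓝 (X i, X (i + 1), X (i + 2)))
        (𝓝 (X i, X (i + 1))) := Continuous.tendsto (by fun_prop) _
    have hp2 : Tendsto (fun q : ℝ × ℝ × ℝ => (q.2.1, q.2.2)) (𝓝 (X i, X (i + 1), X (i + 2)))
        (𝓝 (X (i + 1), X (i + 2))) := Continuous.tendsto (by fun_prop) _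
    have c11 := (((continuousOn_L11 hU hL).continuousAt (hU.mem_nhds (hXU (i + 1)))).tendsto).comp
      hp2
    have c12 := (((continuousOn_L12 hU hL).continuousAt (hU.mem_nhds (hXU i))).tendsto).comp hp1
    have c12' := (((continuousOn_L12 hU hL).continuousAt (hU.mem_nhds (hXU (i + 1)))).tendsto).comp
      hp2
    have c22 := (((continuousOn_L22 hU hL).continuousAt (hU.mem_nhds (hXU i))).tendsto).comp hp1
    exact eventually_small_triple ((((c12.mul_const (ξ i)).add
      ((c22.add c11).mul_const (ξ (i + 1)))).add
      (c12'.mul_const (ξ (i + 2)))).eventually (eventually_lt_nhds (hJ i)))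
  obtain ⟨ε, ⟨h1, h2⟩, hε⟩ := ((hev1.and hev2).and self_mem_nhdsWithin).exists
  refine ⟨ε, hε, fun y hy0 hyn hy => ?_⟩
  set h : ℕ → ℝ := fun i => y i - X i with hh
  have hclose : ∀ t ∈ Icc (0 : ℝ) 1, ∀ i ≤ n, |X i + t * h i - X i| < ε := by
    intro t ht i hi
    rw [add_sub_cancel_left, abs_mul, abs_of_nonneg ht.1]
    exact (mul_le_of_le_one_left (abs_nonneg _) ht.2).trans_lt (hy i hi)
  have hmem : ∀ t ∈ Icc (0 : ℝ) 1, ∀ i < n,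
      (X i + t * h i, X (i + 1) + t * h (i + 1)) ∈ U := fun t ht i hi =>
    h1 i (Finset.mem_range.2 hi) _ _ (hclose t ht i hi.le) (hclose t ht (i + 1) hi)
  have h0 : h 0 = 0 := by simp [hh, hy0]
  have hn : h n = 0 := by simp [hh, hyn]
  -- Along the straight path from `X` to `y` the action is concave, by the supersolution that works
  -- at every intermediate sequence, and it is critical at the start.
  have := le_of_second_deriv_nonpos
    (fun t ht => hasDerivAt_segAction hU hL (hmem t ht))
    (fun t ht => hasDerivAt_firstVar hU hL (hmem t ht))
    (by simpa using firstVar_eq_zero hX h0 hn)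
    (fun t ht => tridiagonal_nonpos (fun i hi => hL12 _ (hmem t ht i hi)) hξ
      (fun i hi => (h2 i (Finset.mem_range.2 (by omega)) _ _ _ (hclose t ht i (by omega))
        (hclose t ht (i + 1) (by omega)) (hclose t ht (i + 2) (by omega))).le) h0 hn)
  simpa [hh] using this

/-- The second variation at a local maximum is nowhere positive. -/
theorem secondVar_nonpos_of_isLocalMax (hU : IsOpen U)
    (hL : ContDiffOn ℝ 2 (fun q : ℝ × ℝ => L q.1 q.2) U) {X h : ℕ → ℝ}
    (hXU : ∀ i, (X i, X (i + 1)) ∈ U)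
    (hX : ∀ i, d2 L (X i) (X (i + 1)) + d1 L (X (i + 1)) (X (i + 2)) = 0) {n : ℕ}
    (h0 : h 0 = 0) (hn : h n = 0)
    (hmax : IsLocalMax (fun t : ℝ => segAction L n fun i => X i + t * h i) 0) :
    secondVar L n X h ≤ 0 := by
  by_contra! hpos
  set φ : ℝ → ℝ := fun t : ℝ => segAction L n fun i => X i + t * h i with hφ
  have hev : ∀ᶠ t in 𝓝 (0 : ℝ), ∀ i ∈ Finset.range n,
      (X i + t * h i, X (i + 1) + t * h (i + 1)) ∈ U := by
    rw [Finset.eventually_all]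
    intro i _
    have hc : Continuous fun t : ℝ => (X i + t * h i, X (i + 1) + t * h (i + 1)) := by fun_prop
    exact hc.continuousAt.eventually (by simpa using hU.mem_nhds (hXU i))
  simp only [Finset.mem_range] at hev
  have hd1 : deriv φ =ᶠ[𝓝 0] fun t => firstVar L n (fun i => X i + t * h i) h := by
    filter_upwards [hev] with t ht
    exact (hasDerivAt_segAction hU hL ht).deriv
  have hd2 : deriv (deriv φ) 0 = secondVar L n X h := by
    rw [hd1.deriv_eq, (hasDerivAt_firstVar hU hL hev.self_of_nhds).deriv]
    simp
  have hcrit : deriv φ 0 = 0 := by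
    rw [hd1.eq_of_nhds]
    simpa using firstVar_eq_zero hX h0 hn
  -- A positive second derivative makes the local maximum a local minimum as well, hence `φ` is
  -- locally constant, with zero second derivative.
  have hmin : IsLocalMin φ 0 := isLocalMin_of_deriv_deriv_pos (hd2 ▸ hpos) hcrit
    (hasDerivAt_segAction hU hL hev.self_of_nhds).continuousAt
  have hconst : φ =ᶠ[𝓝 0] fun _ => φ 0 := by
    filter_upwards [hmin, hmax] with t h1 h2
    exact le_antisymm h2 h1
  have : deriv (deriv φ) 0 = 0 := by
    rw [hconst.deriv.deriv_eq]
    simp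
  rw [hd2] at this
  exact hpos.ne' this

end Variation

/-! ### Local maximality against conjugate points. -/

section Maximizing

variable {P : ℝ} [Fact (0 < P)] {I : Set ℝ} {T : TwistMap P I} {L : ℝ → ℝ → ℝ}

theorem locallyMaximizing_of_vertField_pos (hI : IsOpen I) (hL : IsGeneratingFunction T L)
    (hL12 : ∀ q ∈ T.pairs, 0 < L12 L q.1 q.2) (hpos : ∀ n p, 0 < T.vertField p (n + 1))
    {x : ℤ → ℝ} (hx : IsConfiguration T L x) : LocallyMaximizing L x := by
  intro M N hMN
  obtain ⟨p, rfl⟩ := exists_orbit_of_isConfiguration hL hx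
  -- The vertical vector starts one step early, so that the Jacobi field is already positive at `M`.
  set q := T.orbit p (M - 1) with hq
  have horb : ∀ i : ℕ, T.orbit q (i + 1 : ℕ) = T.orbit p (M + i) := fun i => by
    rw [hq, ← T.orbit_add]
    congr 1
    push_cast
    ring
  obtain ⟨ε, hε, h⟩ := exists_segAction_le (T.isOpen_pairs hI) hL.contDiffOn hL12
    (X := fun i => T.config p (M + i)) (u := fun i => T.vertField q (i + 1))
    (fun i => by simpa [add_assoc] using hx.1 (M + i))
    (fun i => by
      have := hx.2 (M + i + 1)
      rw [add_sub_cancel_right] at this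
      push_cast
      rwa [← add_assoc, show M + ((i : ℤ) + 2) = M + i + 1 + 1 by ring])
    (fun i => by
      have := vertField_jacobi hI hL q (i + 1)
      have e : ((i + 1 : ℕ) : ℤ) + 1 = ((i + 1 + 1 : ℕ) : ℤ) := by push_cast; ring
      rw [e, horb, horb] at this
      simp only [TwistMap.hess11, TwistMap.hess12, TwistMap.hess22, T.lift_orbit_fst,
        ← T.config_eq] at this
      push_cast at this ⊢
      rw [show M + ((i : ℤ) + 1) + 1 = M + (i + 2) by ring, add_assoc M (i : ℤ) 1] at this
      exact this)
    (N - M).toNat (fun i _ => hpos i q)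
  have hN : M + ((N - M).toNat : ℤ) = N := by omega
  refine ⟨ε, hε, fun y hyM hyN hy => ?_⟩
  rw [action_eq_segAction, action_eq_segAction]
  refine h (fun i => y (M + i)) (by simpa using hyM) (by simpa only [hN] using hyN)
    fun i hi => hy _ ?_
  rw [Finset.mem_Icc]
  omega

/-- A Jacobi field between two zeros has zero second variation. Extended by `0` it has a corner at
the second zero, and moving that corner on a segment one step longer changes the second variation to
first order, so it can be made positive. -/
theorem noConjugatePoints_of_locallyMaximizing (hI : IsOpen I) (hL : IsGeneratingFunction T L)
    (hL12 : ∀ q ∈ T.pairs, 0 < L12 L q.1 q.2) {x : ℤ → ℝ} (hx : IsConfiguration T L x)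
    (hmax : LocallyMaximizing L x) : NoConjugatePoints L x := by
  have main : ∀ M N : ℤ, M < N → ¬ Conjugate L x M N := by
    rintro M N hMN ⟨ξ, hξ, hne, hM, hN⟩
    obtain ⟨m, hm⟩ : ∃ m : ℕ, N = M + (m + 1 : ℕ) := ⟨(N - M - 1).toNat, by omega⟩
    have hb : ∀ n, 0 < L12 L (x n) (x (n + 1)) := fun n => hL12 _ (hx.1 n)
    set X : ℕ → ℝ := fun i => x (M + i) with hXdef
    set u : ℕ → ℝ := fun i => ξ (M + i) with hudef
    have hXU : ∀ i, (X i, X (i + 1)) ∈ T.pairs := fun i => by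
      simpa [hXdef, add_assoc] using hx.1 (M + i)
    have hX : ∀ i, d2 L (X i) (X (i + 1)) + d1 L (X (i + 1)) (X (i + 2)) = 0 := fun i => by
      have := hx.2 (M + i + 1)
      rw [add_sub_cancel_right] at this
      simp only [hXdef]
      push_cast
      rwa [← add_assoc, show M + ((i : ℤ) + 2) = M + i + 1 + 1 by ring]
    have hu : ∀ i, L12 L (X i) (X (i + 1)) * u i
        + (L22 L (X i) (X (i + 1)) + L11 L (X (i + 1)) (X (i + 2))) * u (i + 1)
        + L12 L (X (i + 1)) (X (i + 2)) * u (i + 2) = 0 := fun i => by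
      have := hξ (M + i + 1)
      rw [add_sub_cancel_right] at this
      simp only [hXdef, hudef]
      push_cast
      rwa [← add_assoc, show M + ((i : ℤ) + 2) = M + i + 1 + 1 by ring]
    have hu0 : u 0 = 0 := by simpa [hudef] using hM
    have hum1 : u (m + 1) = 0 := by simp only [hudef]; rw [← hm]; exact hN
    have hum : u m ≠ 0 := by
      intro h0
      apply hne
      have hall : ∀ k : ℤ, ξ (M + m + k) = 0 ∧ ξ (M + m + k + 1) = 0 := by
        intro k
        induction k using Int.induction_on with
        | zero =>
          refine ⟨by simpa using h0, ?_⟩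
          rw [add_zero, add_assoc]
          exact_mod_cast hum1
        | succ k ih =>
          rw [← add_assoc]
          refine ⟨ih.2, ?_⟩
          have := hξ (M + m + k + 1)
          rw [add_sub_cancel_right, ih.1, ih.2] at this
          simpa [(hb _).ne'] using this
        | pred k ih =>
          rw [← add_sub_assoc, sub_add_cancel]
          refine ⟨?_, ih.1⟩
          have := hξ (M + m + -k)
          rw [ih.1, ih.2] at this
          have hb' := hb (M + m + -k - 1)
          rw [sub_add_cancel] at hb'
          simpa [hb'.ne'] using this
      funext k
      have := (hall (k - (M + m))).1
      rwa [add_sub_cancel] at this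
    set B := L12 L (X m) (X (m + 1)) with hBdef
    set K := L22 L (X m) (X (m + 1)) + L11 L (X (m + 1)) (X (m + 2)) with hK
    have hB : 0 < B := hL12 _ (hXU m)
    -- The form to be made positive is `2 * B * u m * e + K * e ^ 2`: `e` has the sign of `B * u m`,
    -- and the denominator keeps the quadratic term dominated, whatever the sign of `K`.
    set e := B * u m / (1 + |K|) with he
    set h : ℕ → ℝ := fun i => if i ≤ m then u i else if i = m + 1 then e else 0 with hh
    have h_le : ∀ i ≤ m, h i = u i := fun i hi => by simp [hh, hi]
    have h_m1 : h (m + 1) = e := by simp [hh]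
    have h_m2 : h (m + 2) = 0 := by simp [hh]
    have hQ : secondVar L (m + 2) X h = 2 * B * u m * e + K * e ^ 2 := by
      have hfree : secondVar L (m + 1) X u = 0 := by
        rw [secondVar, sum_add_shift
          (fun i => (L11 L (X i) (X (i + 1)) * u i + L12 L (X i) (X (i + 1)) * u (i + 1)) * u i)
          (fun i => (L12 L (X i) (X (i + 1)) * u i + L22 L (X i) (X (i + 1)) * u (i + 1))
            * u (i + 1)), hu0, hum1]
        simp only [mul_zero, zero_add, add_zero]
        refine Finset.sum_eq_zero fun i _ => ?_
        linear_combination u (i + 1) * hu i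
      rw [secondVar, Finset.sum_range_succ] at hfree
      rw [secondVar, Finset.sum_range_succ, Finset.sum_range_succ, h_m1, h_m2, h_le m le_rfl]
      rw [hum1] at hfree
      have hsum : ∑ i ∈ Finset.range m,
          ((L11 L (X i) (X (i + 1)) * h i + L12 L (X i) (X (i + 1)) * h (i + 1)) * h i
            + (L12 L (X i) (X (i + 1)) * h i + L22 L (X i) (X (i + 1)) * h (i + 1)) * h (i + 1))
          = ∑ i ∈ Finset.range m,
          ((L11 L (X i) (X (i + 1)) * u i + L12 L (X i) (X (i + 1)) * u (i + 1)) * u i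
            + (L12 L (X i) (X (i + 1)) * u i + L22 L (X i) (X (i + 1)) * u (i + 1))
              * u (i + 1)) := by
        refine Finset.sum_congr rfl fun i hi => ?_
        rw [Finset.mem_range] at hi
        rw [h_le i hi.le, h_le (i + 1) hi]
      rw [hsum]
      simp only [hK, hBdef]
      linear_combination hfree
    have hQpos : 0 < secondVar L (m + 2) X h := by
      have hK1 : 0 < 1 + |K| := by positivity
      have hBu : 0 < (B * u m) ^ 2 := by positivity
      have hKabs := neg_abs_le K
      have e1 : secondVar L (m + 2) X h = (B * u m) ^ 2 * (2 * (1 + |K|) + K) / (1 + |K|) ^ 2 := by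
        rw [hQ, he]
        field_simp
      rw [e1]
      have : 0 < 2 * (1 + |K|) + K := by linarith [abs_nonneg K]
      positivity
    refine hQpos.not_ge (secondVar_nonpos_of_isLocalMax (T.isOpen_pairs hI) hL.contDiffOn hXU hX
      (by rw [h_le 0 (Nat.zero_le _), hu0]) h_m2 ?_)
    obtain ⟨ε, hε, hloc⟩ := hmax M (M + (m + 2 : ℕ)) (by push_cast; omega)
    have hsmall : ∀ᶠ t in 𝓝 (0 : ℝ), ∀ i ∈ Finset.range (m + 3), |t * h i| < ε := by
      rw [Finset.eventually_all]
      intro i _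
      have hc : Continuous fun t : ℝ => |t * h i| := by fun_prop
      exact (hc.tendsto 0).eventually (eventually_lt_nhds (by simpa using hε))
    have hlen : (M + (m + 2 : ℕ) - M).toNat = m + 2 := by omega
    filter_upwards [hsmall] with t ht
    have := hloc (fun k => x k + t * h (k - M).toNat) (by simp [h_le, hu0])
      (by simp only [hlen, h_m2, mul_zero, add_zero]) (fun k hk => by
        rw [add_sub_cancel_left]
        rw [Finset.mem_Icc] at hk
        exact ht _ (by rw [Finset.mem_range]; omega))
    rw [action_eq_segAction, action_eq_segAction, hlen] at this
    simpa using this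
  intro M N hMN hconj
  rcases lt_or_gt_of_ne hMN with h | h
  · exact main M N h hconj
  · obtain ⟨ξ, h1, h2, h3, h4⟩ := hconj
    exact main N M h ⟨ξ, h1, h2, h4, h3⟩

end Maximizing

/-! ### Passage between the strip and the cylinder. -/

section Descent

variable {P : ℝ} {I : Set ℝ}

theorem isOpenMap_proj : IsOpenMap (proj P I) :=
  QuotientAddGroup.isOpenMap_coe.prodMap IsOpenMap.id

theorem proj_surjective : Function.Surjective (proj P I) := by
  rintro ⟨z, Φ⟩
  obtain ⟨x, rfl⟩ := QuotientAddGroup.mk_surjective z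
  exact ⟨(x, Φ), rfl⟩

variable [Fact (0 < P)]

/-- A measurable function on the universal cover that is invariant under the deck translation
descends to the cylinder. -/
theorem exists_measurable_descent {f : ℝ × I → ℝ} (hf : Measurable f)
    (hper : ∀ p : ℝ × I, f (p.1 + P, p.2) = f p) :
    ∃ F : Cyl P I → ℝ, Measurable F ∧ ∀ p, F (proj P I p) = f p := by
  refine ⟨fun z => f ((AddCircle.measurableEquivIco P 0 z.1 : ℝ), z.2), ?_, fun p => ?_⟩
  · refine hf.comp (Measurable.prodMk ?_ measurable_snd)
    exact measurable_subtype_coe.comp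
      ((AddCircle.measurableEquivIco P 0).measurable.comp measurable_fst)
  · have h : Function.Periodic (fun x => f (x, p.2)) P := fun x => hper (x, p.2)
    exact h.sub_zsmul_eq _

/-- This is what upgrades almost-everywhere inequalities between continuous functions to everywhere.
-/
theorem isOpenPosMeasure_area (hI : IsOpen I) : (area P I).IsOpenPosMeasure := by
  have : (Measure.comap (Subtype.val : I → ℝ) volume).IsOpenPosMeasure :=
    Measure.IsOpenPosMeasure.comap _ hI.isOpenEmbedding_subtypeVal
  have : SigmaFinite (Measure.comap (Subtype.val : I → ℝ) volume) :=
    SigmaFinite.of_map _ measurable_subtype_coe.aemeasurable (by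
      rw [map_comap_subtype_coe hI.measurableSet]
      infer_instance)
  exact Measure.prod.instIsOpenPosMeasure

variable (T : TwistMap P I)

theorem TwistMap.orbit_translate (p : ℝ × I) (n : ℤ) :
    T.orbit (p.1 + P, p.2) n = ((T.orbit p n).1 + P, (T.orbit p n).2) := by
  refine ((T.eq_orbit (σ := fun n => ((T.orbit p n).1 + P, (T.orbit p n).2)) (fun n => ?_)
    n).trans (by simp)).symm
  rw [T.lift_translate, T.orbit_add_one]

theorem TwistMap.differential_translate (hI : IsOpen I) (p : ℝ × I) :
    T.differential (p.1 + P, p.2) = T.differential p := by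
  have h1 := (T.hasStrictFDerivAt hI (p.1 + P, p.2)).hasFDerivAt
  have h2 : HasFDerivAt (fun q : ℝ × ℝ => q + (P, 0)) (ContinuousLinearMap.id ℝ (ℝ × ℝ))
      (p.1, (p.2 : ℝ)) := (hasFDerivAt_id _).add_const _
  have h3 : ((p.1 + P, (p.2 : ℝ)) : ℝ × ℝ) = (p.1, (p.2 : ℝ)) + (P, 0) := by simp
  simp only [h3] at h1
  have h4 := HasFDerivAt.comp (f := fun q : ℝ × ℝ => q + (P, 0)) _ h1 h2
  refine h4.unique (((T.hasStrictFDerivAt hI p).hasFDerivAt.add_const (P, 0)).congr_of_eventuallyEq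
    ?_)
  filter_upwards [(isOpen_strip hI).mem_nhds (coe_mem_strip p)] with q hq
  obtain ⟨p', rfl⟩ := exists_coe_eq hq
  have h5 := planar_coe T.lift (p'.1 + P, p'.2)
  rw [T.lift_translate] at h5
  simpa using h5

theorem TwistMap.push_translate (hI : IsOpen I) (p : ℝ × I) (n : ℕ) :
    T.push (p.1 + P, p.2) n = T.push p n := by
  induction n with
  | zero => rfl
  | succ n ih =>
    rw [TwistMap.push, TwistMap.push, ih, T.orbit_translate, T.differential_translate hI]

theorem TwistMap.vertField_translate (hI : IsOpen I) (p : ℝ × I) (n : ℕ) :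
    T.vertField (p.1 + P, p.2) n = T.vertField p n := by
  rw [TwistMap.vertField, TwistMap.vertField, T.push_translate hI]

theorem TwistMap.map_zpow_proj (p : ℝ × I) (n : ℤ) :
    ((T.map.toEquiv : Equiv.Perm (Cyl P I)) ^ n) (proj P I p) = proj P I (T.orbit p n) := by
  induction n using Int.induction_on with
  | zero => simp
  | succ n ih =>
    rw [add_comm, zpow_add, Equiv.Perm.mul_apply, ih, add_comm, T.orbit_add_one, ← T.map_proj,
      zpow_one]
    rfl
  | pred n ih =>
    rw [sub_eq_neg_add, zpow_add, Equiv.Perm.mul_apply, ih, zpow_neg_one, Equiv.Perm.inv_eq_iff_eq]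
    change _ = T.map _
    rw [T.map_proj, ← T.orbit_add_one]
    congr 2
    ring

theorem TwistMap.map_iterate_proj (p : ℝ × I) (n : ℕ) :
    T.map^[n] (proj P I p) = proj P I (T.orbit p n) := by
  induction n with
  | zero => simp
  | succ n ih =>
    rw [Function.iterate_succ_apply', ih, T.map_proj, ← T.orbit_add_one]
    push_cast
    rfl

end Descent

/-! ### Step relation of the cocycle. -/

section Cocycle

variable {Ω : Type*} (T : Equiv.Perm Ω) {ν : Ω → ℝ}

theorem cocycle_zero (ν : Ω → ℝ) (z : Ω) : cocycle T ν z 0 = 1 := by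
  change ∏ k ∈ Finset.range 0, ν ((T ^ k) z) = 1
  simp

theorem cocycle_add_one (hν : ∀ z, ν z ≠ 0) (z : Ω) (n : ℤ) :
    cocycle T ν z (n + 1) = cocycle T ν z n * ν ((T ^ n) z) := by
  rcases n with n | n
  · change ∏ k ∈ Finset.range (n + 1), ν ((T ^ k) z) = _
    rw [Finset.prod_range_succ]
    rfl
  · have hsymm : ∀ k : ℕ, (T ^ (Int.negSucc k)) z = (T.symm ^ (k + 1)) z := fun k => by
      rw [zpow_negSucc, ← inv_pow]
      rfl
    rw [hsymm]
    -- The step from `-1` to `0` crosses between the two defining clauses and is treated separately.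
    rcases n with _ | n
    · change cocycle T ν z 0 = (∏ k ∈ Finset.range 1, ν ((T.symm ^ (k + 1)) z))⁻¹ * _
      rw [cocycle_zero, Finset.prod_range_one, inv_mul_cancel₀ (hν _)]
    · change (∏ k ∈ Finset.range (n + 1), ν ((T.symm ^ (k + 1)) z))⁻¹
        = (∏ k ∈ Finset.range (n + 1 + 1), ν ((T.symm ^ (k + 1)) z))⁻¹ * _
      rw [Finset.prod_range_succ _ (n + 1), mul_inv, mul_assoc, inv_mul_cancel₀ (hν _), mul_one]

end Cocycle

/-! ### The limiting solution of the Riccati equation. -/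

section Riccati

variable {P : ℝ} [Fact (0 < P)] {I : Set ℝ} {T : TwistMap P I} {L : ℝ → ℝ → ℝ}

/-- The ratio at times `1` and `0` of the Jacobi field that vanishes at time `-(m + 1)`. -/
noncomputable def TwistMap.ratio (T : TwistMap P I) (m : ℕ) (p : ℝ × I) : ℝ :=
  T.vertField (T.orbit p (-(m + 1 : ℕ))) (m + 2) / T.vertField (T.orbit p (-(m + 1 : ℕ))) (m + 1)

theorem ratio_pos (hpos : ∀ n p, 0 < T.vertField p (n + 1)) (m : ℕ) (p : ℝ × I) :
    0 < T.ratio m p :=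
  div_pos (hpos _ _) (hpos _ _)

/-- The field vanishes one step earlier, so the term `L₁₂ / ratio` of the Riccati recursion is
absent; this positive missing term starts the monotonicity argument. -/
theorem ratio_zero_lift (hI : IsOpen I) (hL : IsGeneratingFunction T L)
    (hpos : ∀ n p, 0 < T.vertField p (n + 1)) (p : ℝ × I) :
    T.hess22 L p + T.hess11 L (T.lift p) + T.hess12 L (T.lift p) * T.ratio 0 (T.lift p) = 0 := by
  have e : T.orbit (T.lift p) (-(0 + 1 : ℕ)) = p := by
    rw [← T.orbit_one, ← T.orbit_add]
    simp
  have h := vertField_jacobi hI hL p 0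
  simp only [Nat.cast_zero, T.orbit_zero, zero_add, T.orbit_one, vertField_zero, mul_zero] at h
  rw [TwistMap.ratio, e]
  have h1 := (hpos 0 p).ne'
  simp only [zero_add] at h1 ⊢
  field_simp
  linarith

theorem ratio_succ_lift (hI : IsOpen I) (hL : IsGeneratingFunction T L)
    (hpos : ∀ n p, 0 < T.vertField p (n + 1)) (m : ℕ) (p : ℝ × I) :
    T.hess12 L p / T.ratio m p + (T.hess22 L p + T.hess11 L (T.lift p))
      + T.hess12 L (T.lift p) * T.ratio (m + 1) (T.lift p) = 0 := by
  set q := T.orbit p (-(m + 1 : ℕ)) with hq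
  have e : T.orbit (T.lift p) (-(m + 1 + 1 : ℕ)) = q := by
    rw [← T.orbit_one, ← T.orbit_add, hq]
    congr 1
  have e1 : T.orbit q (m + 1 : ℕ) = p := by
    rw [hq, ← T.orbit_add]
    simp
  have e2 : T.orbit q ((m + 1 : ℕ) + 1) = T.lift p := by rw [T.orbit_add_one, e1]
  have h := vertField_jacobi hI hL q (m + 1)
  rw [e1, e2] at h
  rw [TwistMap.ratio, TwistMap.ratio, e, ← hq]
  have h1 := (hpos m q).ne'
  have h2 := (hpos (m + 1) q).ne'
  simp only [add_assoc, Nat.reduceAdd] at h h1 h2 ⊢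
  field_simp
  linarith

/-- The Riccati step expresses the next ratio as an increasing function of the current one, so an
inequality between two ratios propagates. -/
theorem ratio_succ_le (hI : IsOpen I) (hL : IsGeneratingFunction T L)
    (hL12 : ∀ q ∈ T.pairs, 0 < L12 L q.1 q.2)
    (hpos : ∀ n p, 0 < T.vertField p (n + 1)) (m : ℕ) (p : ℝ × I) :
    T.ratio (m + 1) p ≤ T.ratio m p := by
  induction m generalizing p with
  | zero =>
    obtain ⟨p, rfl⟩ := T.lift.surjective p
    have h1 := ratio_zero_lift hI hL hpos p
    have h2 := ratio_succ_lift hI hL hpos 0 p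
    have h3 : 0 < T.hess12 L p / T.ratio 0 p := div_pos (hess12_pos hL12 p) (ratio_pos hpos 0 p)
    exact le_of_mul_le_mul_left (by linarith) (hess12_pos hL12 (T.lift p))
  | succ m ih =>
    obtain ⟨p, rfl⟩ := T.lift.surjective p
    have h1 := ratio_succ_lift hI hL hpos m p
    have h2 := ratio_succ_lift hI hL hpos (m + 1) p
    have h3 : T.hess12 L p / T.ratio m p ≤ T.hess12 L p / T.ratio (m + 1) p :=
      div_le_div_of_nonneg_left (hess12_pos hL12 p).le (ratio_pos hpos _ p) (ih p)
    exact le_of_mul_le_mul_left (by linarith) (hess12_pos hL12 (T.lift p))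

theorem continuous_ratio (hI : IsOpen I) (hpos : ∀ n p, 0 < T.vertField p (n + 1)) (m : ℕ) :
    Continuous (T.ratio m) :=
  ((T.continuous_vertField hI _).comp (T.continuous_orbit _)).div
    ((T.continuous_vertField hI _).comp (T.continuous_orbit _)) fun _ => (hpos _ _).ne'

theorem ratio_translate (hI : IsOpen I) (m : ℕ) (p : ℝ × I) :
    T.ratio m (p.1 + P, p.2) = T.ratio m p := by
  simp only [TwistMap.ratio, T.orbit_translate, T.vertField_translate hI]

/-- If no Jacobi field has two zeros, the Riccati equation has a positive measurable solution. -/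
theorem exists_riccati_solution (hI : IsOpen I) (hL : IsGeneratingFunction T L)
    (hL12 : ∀ q ∈ T.pairs, 0 < L12 L q.1 q.2)
    (hpos : ∀ n p, 0 < T.vertField p (n + 1)) :
    ∃ ρ : ℝ × I → ℝ, Measurable ρ ∧ (∀ p, 0 < ρ p) ∧ (∀ p : ℝ × I, ρ (p.1 + P, p.2) = ρ p) ∧
      ∀ p, T.hess12 L p / ρ p + (T.hess22 L p + T.hess11 L (T.lift p))
        + T.hess12 L (T.lift p) * ρ (T.lift p) = 0 := by
  have hbdd : ∀ p, BddBelow (range fun m => T.ratio m p) := fun p =>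
    ⟨0, by rintro _ ⟨m, rfl⟩; exact (ratio_pos hpos m p).le⟩
  have hlim : ∀ p, Tendsto (fun m => T.ratio m p) atTop (𝓝 (⨅ m, T.ratio m p)) := fun p =>
    tendsto_atTop_ciInf (antitone_nat_of_succ_le fun m => ratio_succ_le hI hL hL12 hpos m p)
      (hbdd p)
  have hposρ : ∀ p, 0 < ⨅ m, T.ratio m p := by
    intro p
    have hb := hess12_pos hL12 p
    set a := T.hess22 L p + T.hess11 L (T.lift p) with ha
    -- Positivity of the next ratio bounds the current one below by `L₁₂ / (-a)`, uniformly in `m`,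
    -- so the limit cannot vanish.
    have key : ∀ m, T.hess12 L p < -a * T.ratio m p := fun m => by
      have h := ratio_succ_lift hI hL hpos m p
      have h1 := mul_pos (hess12_pos hL12 (T.lift p)) (ratio_pos hpos (m + 1) (T.lift p))
      have h2 : T.hess12 L p / T.ratio m p < -a := by linarith
      rwa [div_lt_iff₀ (ratio_pos hpos m p)] at h2
    have hnega : 0 < -a :=
      pos_of_mul_pos_left (hb.trans (key 0)) (ratio_pos hpos 0 p).le
    refine (div_pos hb hnega).trans_le (le_ciInf fun m => ?_)
    rw [div_le_iff₀ hnega, mul_comm]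
    exact (key m).le
  refine ⟨fun p => ⨅ m, T.ratio m p, ?_, hposρ, fun p => ?_, fun p => ?_⟩
  · exact measurable_of_tendsto_metrizable (fun m => (continuous_ratio hI hpos m).measurable)
      (tendsto_pi_nhds.2 hlim)
  · simp only [ratio_translate hI]
  · have h1 : Tendsto (fun m => T.hess12 L p / T.ratio m p
        + (T.hess22 L p + T.hess11 L (T.lift p))
        + T.hess12 L (T.lift p) * T.ratio (m + 1) (T.lift p)) atTop
        (𝓝 (T.hess12 L p / (⨅ m, T.ratio m p) + (T.hess22 L p + T.hess11 L (T.lift p))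
        + T.hess12 L (T.lift p) * ⨅ m, T.ratio m (T.lift p))) :=
      ((tendsto_const_nhds.div (hlim p) (hposρ p).ne').add_const _).add
        (((hlim (T.lift p)).comp (tendsto_add_atTop_nat 1)).const_mul _)
    simp only [ratio_succ_lift hI hL hpos] at h1
    exact tendsto_nhds_unique h1 tendsto_const_nhds

theorem exists_cocycle_of_vertField_pos (hI : IsOpen I) (hL : IsGeneratingFunction T L)
    (hL12 : ∀ q ∈ T.pairs, 0 < L12 L q.1 q.2)
    (hpos : ∀ n p, 0 < T.vertField p (n + 1)) :
    ∃ ν : Cyl P I → ℝ, Measurable ν ∧ (∀ z, 0 < ν z) ∧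
      ∀ p : ℝ × I, IsJacobiField L (T.config p) (cocycle T.map.toEquiv ν (proj P I p)) := by
  obtain ⟨ρ, hρm, hρpos, hρper, hρ⟩ := exists_riccati_solution hI hL hL12 hpos
  obtain ⟨ν, hνm, hν⟩ := exists_measurable_descent hρm hρper
  have hνpos : ∀ z, 0 < ν z := fun z => by
    obtain ⟨p, rfl⟩ := proj_surjective z
    rw [hν]
    exact hρpos p
  refine ⟨ν, hνm, hνpos, fun p => (isJacobiField_config_iff p _).2 fun n => ?_⟩
  have hc : ∀ n, cocycle T.map.toEquiv ν (proj P I p) (n + 1)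
      = cocycle T.map.toEquiv ν (proj P I p) n * ρ (T.orbit p n) := fun n => by
    rw [cocycle_add_one _ fun z => (hνpos z).ne', T.map_zpow_proj, hν]
  have h := hρ (T.orbit p n)
  have h1 := (hρpos (T.orbit p n)).ne'
  rw [show n + 2 = n + 1 + 1 by ring, hc (n + 1), hc n, T.orbit_add_one]
  field_simp at h
  linear_combination cocycle T.map.toEquiv ν (proj P I p) n * h

end Riccati

/-! ### Invariant line fields. -/

section Subbundle

variable {P : ℝ} [Fact (0 < P)] {I : Set ℝ} {T : TwistMap P I} {L : ℝ → ℝ → ℝ}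

/-- No periodicity of `L` is assumed; it is recovered for the second derivatives from the
periodicity of the differential of the lift. -/
theorem hess12_translate (hI : IsOpen I) (hL : IsGeneratingFunction T L) (p : ℝ × I) :
    T.hess12 L (p.1 + P, p.2) = T.hess12 L p := by
  have h1 := vertField_one hI hL p
  have h2 := vertField_one hI hL (p.1 + P, p.2)
  rw [T.vertField_translate hI] at h2
  rw [eq_inv_of_mul_eq_one_left h1, eq_inv_of_mul_eq_one_left h2]

theorem hess11_translate (hI : IsOpen I) (hL : IsGeneratingFunction T L) (p : ℝ × I) :
    T.hess11 L (p.1 + P, p.2) = T.hess11 L p := by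
  have h1 := (differential_relations hI hL p (1, 0)).1
  have h2 := (differential_relations hI hL (p.1 + P, p.2) (1, 0)).1
  rw [T.differential_translate hI, hess12_translate hI hL] at h2
  simp only [mul_one] at h1 h2
  linarith

theorem exists_subbundle_of_cocycle (hI : IsOpen I) (hL : IsGeneratingFunction T L)
    (hL12 : ∀ q ∈ T.pairs, 0 < L12 L q.1 q.2)
    (h : ∃ ν : Cyl P I → ℝ, Measurable ν ∧ (∀ z, 0 < ν z) ∧
      ∀ p : ℝ × I, IsJacobiField L (T.config p) (cocycle T.map.toEquiv ν (proj P I p))) :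
    ∃ l : Cyl P I → Submodule ℝ (ℝ × ℝ), IsMonotoneInvariantSubbundle T l := by
  obtain ⟨ν, hνm, hνpos, hν⟩ := h
  obtain ⟨A, hAm, hA⟩ := exists_measurable_descent (continuous_hess11 hI hL).measurable
    (hess11_translate hI hL)
  obtain ⟨B, hBm, hB⟩ := exists_measurable_descent (continuous_hess12 hI hL).measurable
    (hess12_translate hI hL)
  -- By the first differential relation, this is the vector with `dx = 1` whose image has `dx = ν
  -- z`. The Jacobi equation makes that image `ν z` times the corresponding vector at the next
  -- point.
  set w : Cyl P I → ℝ × ℝ := fun z => (1, -(A z + B z * ν z)) with hw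
  have hDw : ∀ p : ℝ × I, T.differential p (w (proj P I p))
      = ν (proj P I p) • w (T.map (proj P I p)) := by
    intro p
    obtain ⟨h1, h2⟩ := differential_relations hI hL p (w (proj P I p))
    have hfst : (T.differential p (w (proj P I p))).1 = ν (proj P I p) := by
      refine mul_left_cancel₀ (hess12_pos hL12 p).ne' ?_
      simp only [hw, hA, hB] at h1 ⊢
      linarith
    refine Prod.ext (by rw [hfst]; simp [hw]) ?_
    rw [h2, hfst]
    have hJ := (isJacobiField_config_iff p _).1 (hν p) 0
    have hν' := fun z => (hνpos z).ne'
    have hc1 : cocycle T.map.toEquiv ν (proj P I p) 1 = ν (proj P I p) := by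
      rw [← zero_add (1 : ℤ), cocycle_add_one _ hν', cocycle_zero, T.map_zpow_proj, T.orbit_zero,
        one_mul]
    rw [show (0 : ℤ) + 2 = 0 + 1 + 1 by ring, cocycle_add_one _ hν' _ (0 + 1), cocycle_zero,
      T.map_zpow_proj] at hJ
    simp only [zero_add, T.orbit_zero, T.orbit_one, hc1] at hJ
    simp only [hw, T.map_proj, hA, hB, Prod.smul_snd, smul_eq_mul]
    linear_combination hJ
  refine ⟨fun z => Submodule.span ℝ {w z}, ⟨w, ?_, ?_⟩, ?_, ?_, ?_⟩
  · exact measurable_const.prodMk (hAm.add (hBm.mul hνm)).neg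
  · refine Eventually.of_forall fun z => ⟨fun h => ?_, rfl⟩
    simpa [hw] using congrArg Prod.fst h
  · refine Eventually.of_forall fun z hz => ?_
    obtain ⟨c, hc⟩ := Submodule.mem_span_singleton.1 hz
    have h1 := congrArg Prod.fst hc
    have h2 := congrArg Prod.snd hc
    simp only [hw, Prod.smul_fst, Prod.smul_snd, smul_eq_mul, mul_one] at h1 h2
    rw [h1, zero_mul] at h2
    exact zero_ne_one h2
  · refine Eventually.of_forall ?_
    rintro _ p rfl
    rw [Submodule.map_span, image_singleton]
    change Submodule.span ℝ {T.differential p (w (proj P I p))} = _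
    rw [hDw, Submodule.span_singleton_smul_eq (hνpos _).ne'.isUnit]
  · refine Eventually.of_forall ?_
    rintro _ p rfl v hv hv1
    obtain ⟨c, rfl⟩ := Submodule.mem_span_singleton.1 hv
    rw [map_smul, hDw]
    simp only [hw, Prod.smul_fst, smul_eq_mul, mul_one] at hv1 ⊢
    exact mul_pos hv1 (hνpos _)

/-- A vector field along a forward orbit whose `x`-component stays positive forces the images of
the vertical vector to point in one direction. -/
theorem vertField_pos_of_push_pos (hI : IsOpen I) (hL : IsGeneratingFunction T L)
    (hL12 : ∀ q ∈ T.pairs, 0 < L12 L q.1 q.2) {p : ℝ × I} {v : ℝ × ℝ}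
    (hv : ∀ n, 0 < (T.push p n v).1) (n : ℕ) : 0 < T.vertField p (n + 1) := by
  have step : ∀ n, 0 ≤ T.vertField p n → 0 < T.vertField p (n + 1) := by
    intro n hn
    -- The Wronskian is the positive constant `v.1`; with both fields nonnegative at time `n`, this
    -- forces the vertical field to be positive at time `n + 1`.
    have h := wronskian_push hI hL p n (0, -1) v
    have hv0 : 0 < v.1 := hv 0
    have hW : 0 < wedge (0, -1) v := by simpa [wedge] using hv0
    rw [← h] at hW
    have h1 := pos_of_mul_pos_right hW (hess12_pos hL12 _).le
    have h2 : 0 ≤ T.vertField p n * (T.push p (n + 1) v).1 := mul_nonneg hn (hv _).le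
    rw [TwistMap.vertField] at h2
    have h3 : 0 < (T.push p (n + 1) (0, -1)).1 * (T.push p n v).1 := by linarith
    exact pos_of_mul_pos_left h3 (hv n).le
  induction n with
  | zero => exact step 0 le_rfl
  | succ n ih => exact step _ ih.le

theorem ae_vertField_pos (hI : IsOpen I) (hL : IsGeneratingFunction T L)
    (hL12 : ∀ q ∈ T.pairs, 0 < L12 L q.1 q.2) {l : Cyl P I → Submodule ℝ (ℝ × ℝ)}
    (hl : IsMonotoneInvariantSubbundle T l) :
    ∀ᵐ z ∂(area P I), ∀ p : ℝ × I, proj P I p = z → ∀ n, 0 < T.vertField p (n + 1) := by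
  obtain ⟨w, -, hw⟩ := hl.measurable_line
  -- Area preservation lets the almost-everywhere properties hold along the entire forward orbit of
  -- almost every point.
  have hiter : ∀ᵐ z ∂(area P I), ∀ n : ℕ,
      (∀ p : ℝ × I, proj P I p = T.map^[n] z →
        (l (T.map^[n] z)).map (T.differential p : ℝ × ℝ →ₗ[ℝ] ℝ × ℝ) = l (T.map (T.map^[n] z))) ∧
      ∀ p : ℝ × I, proj P I p = T.map^[n] z →
        ∀ v ∈ l (T.map^[n] z), 0 < v.1 → 0 < (T.differential p v).1 := by
    rw [ae_all_iff]
    exact fun n => (T.measurePreserving.iterate n).quasiMeasurePreserving.ae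
      (hl.invariant.and hl.monotone)
  filter_upwards [hw, hl.nonvertical, hiter] with z hwz hnv hit
  rintro p rfl
  obtain ⟨hw0, hlz⟩ := hwz
  have hw1 : (w (proj P I p)).1 ≠ 0 := by
    intro h1
    have h2 : (w (proj P I p)).2 ≠ 0 := fun h2 => hw0 (Prod.ext h1 h2)
    apply hnv
    rw [hlz]
    refine Submodule.mem_span_singleton.2 ⟨(w (proj P I p)).2⁻¹, Prod.ext ?_ ?_⟩
    · simp [h1]
    · simp [h2]
  set v := (w (proj P I p)).1⁻¹ • w (proj P I p) with hv
  refine vertField_pos_of_push_pos hI hL hL12 (v := v) fun n => ?_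
  suffices h : T.push p n v ∈ l (proj P I (T.orbit p n)) ∧ 0 < (T.push p n v).1 from h.2
  induction n with
  | zero =>
    refine ⟨?_, ?_⟩
    · simp only [T.push_zero, Nat.cast_zero, T.orbit_zero, hlz]
      exact Submodule.smul_mem _ _ (Submodule.mem_span_singleton_self _)
    · simp [hv, hw1]
  | succ n ih =>
    obtain ⟨hinv, hmono⟩ := hit n
    rw [T.map_iterate_proj] at hinv hmono
    refine ⟨?_, hmono _ rfl _ ih.1 ih.2⟩
    have h := hinv _ rfl
    rw [T.map_proj, ← T.orbit_add_one] at h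
    push_cast
    rw [← h]
    exact Submodule.mem_map_of_mem ih.1

/-- Continuity only yields nonnegativity at exceptional points. A zero at time `n + 1` would, by the
Jacobi equation with nonnegative neighbours, force a zero at time `n`; two consecutive zeros
contradict the Wronskian with `(1, 0)`, which equals `1`. -/
theorem vertField_pos_of_subbundle (hI : IsOpen I) (hL : IsGeneratingFunction T L)
    (hL12 : ∀ q ∈ T.pairs, 0 < L12 L q.1 q.2) {l : Cyl P I → Submodule ℝ (ℝ × ℝ)}
    (hl : IsMonotoneInvariantSubbundle T l) (n : ℕ) (p : ℝ × I) : 0 < T.vertField p (n + 1) := by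
  have hnonneg : ∀ n p, 0 ≤ T.vertField p n := by
    rintro (_ | n) p
    · exact le_rfl
    by_contra! hneg
    have hopen : IsOpen {q | T.vertField q (n + 1) < 0} :=
      isOpen_lt (T.continuous_vertField hI _) continuous_const
    have := isOpenPosMeasure_area (P := P) hI
    have hmeas := (isOpenMap_proj (P := P) _ hopen).measure_pos (area P I) ⟨_, p, hneg, rfl⟩
    obtain ⟨z, ⟨q, hq, hqz⟩, hz⟩ := ((frequently_ae_iff.2 hmeas.ne').and_eventually
      (ae_vertField_pos hI hL hL12 hl)).exists
    exact (hz q hqz n).not_gt hq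
  refine lt_of_le_of_ne (hnonneg _ p) fun h0 => ?_
  have hJ := vertField_jacobi hI hL p n
  have b0 := hess12_pos hL12 (T.orbit p n)
  have b1 := hess12_pos hL12 (T.orbit p (n + 1))
  rw [← h0, mul_zero, add_zero] at hJ
  have hm0 := mul_nonneg b0.le (hnonneg n p)
  have hm1 := mul_nonneg b1.le (hnonneg (n + 2) p)
  have hz : T.vertField p n = 0 := by
    have : T.hess12 L (T.orbit p n) * T.vertField p n = 0 := by linarith
    simpa [b0.ne'] using this
  have hW := wronskian_push hI hL p n (0, -1) (1, 0)
  rw [← TwistMap.vertField, ← TwistMap.vertField, hz, ← h0] at hW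
  simp [wedge] at hW

end Subbundle

end TwistMaps

theorem theorem3p1 (P : ℝ) [Fact (0 < P)] (I : Set ℝ) (hI_open : IsOpen I)
    (hI_interval : I.OrdConnected) (hI_nonempty : I.Nonempty)
    (T : TwistMaps.TwistMap P I) (L : ℝ → ℝ → ℝ) (hL : TwistMaps.IsGeneratingFunction T L)
    (hL12 : ∀ q ∈ T.pairs, 0 < TwistMaps.L12 L q.1 q.2) :
    List.TFAE [
      ∀ x : ℤ → ℝ, TwistMaps.IsConfiguration T L x → TwistMaps.NoConjugatePoints L x,
      ∀ x : ℤ → ℝ, TwistMaps.IsConfiguration T L x → TwistMaps.LocallyMaximizing L x,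
      ∃ ν : TwistMaps.Cyl P I → ℝ, Measurable ν ∧ (∀ z, 0 < ν z) ∧
        ∀ p : ℝ × I, TwistMaps.IsJacobiField L (T.config p)
          (TwistMaps.cocycle T.map.toEquiv ν (TwistMaps.proj P I p)),
      ∃ l : TwistMaps.Cyl P I → Submodule ℝ (ℝ × ℝ),
        TwistMaps.IsMonotoneInvariantSubbundle T l] := by
  have hpb : (∀ n p, 0 < T.vertField p (n + 1)) →
      ∀ x, TwistMaps.IsConfiguration T L x → TwistMaps.LocallyMaximizing L x := fun h x hx =>
    TwistMaps.locallyMaximizing_of_vertField_pos hI_open hL hL12 h hx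
  have hba : (∀ x, TwistMaps.IsConfiguration T L x → TwistMaps.LocallyMaximizing L x) →
      ∀ x, TwistMaps.IsConfiguration T L x → TwistMaps.NoConjugatePoints L x := fun h x hx =>
    TwistMaps.noConjugatePoints_of_locallyMaximizing hI_open hL hL12 hx (h x hx)
  have hap := TwistMaps.vertField_pos_of_noConjugatePoints hI_open hI_interval hI_nonempty hL hL12
  tfae_have 1 → 2 := fun h => hpb (hap h)
  tfae_have 2 → 3 := fun h =>
    TwistMaps.exists_cocycle_of_vertField_pos hI_open hL hL12 (hap (hba h))
  tfae_have 3 → 4 := TwistMaps.exists_subbundle_of_cocycle hI_open hL hL12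
  tfae_have 4 → 1 := fun ⟨_, hl⟩ =>
    hba (hpb (TwistMaps.vertField_pos_of_subbundle hI_open hL hL12 hl))
  tfae_finish
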